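/- **Theorem (Characterisation of $D_r^{c}$).** Let $X=(X_t)_{t\in[0,T]}$ be a measurable centered Gaussian process with $X_0=0$ on a probability space $(\Omega,\mathcal F,P)$, let $\mathcal F^X_T=\sigma(X_t:0\le t\le T)$ and $L^2_X=L^2(\Omega,\mathcal F_T^X,P)$. Let $\mathfrak H$ be the space of deterministic integrands of $X$, i.e. the Hilbert space completion of the linear span of the indicators $\mathbf 1_{(0,t]}$, $t\in[0,T]$, for the inner product $\langle \mathbf 1_{(0,t]},\mathbf 1_{(0,s]}\rangle=\mathbb E[X_tX_s]$ (elements of norm zero being identified with $0$), and let $I:\mathfrak H\to L^2_X$ be the Wiener integral, the linear isometry with $I(\mathbf 1_{(0,t]})=X_t$. Let $I_k$ denote the multiple Wiener integral of order $k$, defined on the symmetric tensor power $\mathfrak H^{\tilde\otimes k}\subset\mathfrak H^{\otimes k}$: $I_0$ is the identity on $\mathbb R$, and for $k\ge1$, $I_k$ is the continuous linear extension of $h^{\otimes k}\mapsto H_k(I(h))$, $\|h\|=1$, where $H_k$ is the $k$th monic (probabilists') Hermite polynomial. Write $(S\xi)(h)=\mathbb E\big[\xi\exp\{I(h)-\tfrac12\mathbb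 E[I(h)^2]\}\big]$ for $\xi\in L^2_X$, $h\in\mathfrak H$. Suppose that $X$ has an indefinite Wiener integral, i.e. for every $r\in[0,T]$ there is a continuous linear operator $\mathbb I_r:\mathfrak H\to\mathfrak H$ with $\mathbb I_r\mathbf 1_{(0,t]}=\mathbf 1_{(0,t\wedge r]}$ for all $t\in[0,T]$. Let $r\in[0,T]$ and $c\in\mathfrak H$. Let $D_r^c$ be the set of those $\xi\in L^2_X$ for which there is an $\eta\in L^2_X$ with $$(S\xi)\big(\mathbb I_r^*(h+c)-c\big)=(S\eta)(h)\qquad\text{for all }h\in\mathfrak H;$$ for $\xi\in D_r^c$ this $\eta$ is unique and denoted $\widetilde E^c[\xi\,|\,\mathcal F_r^X]$. Put $c_r=\mathbb I_r^*c-c$ and, for $\xi=\sum_{k\ge0}I_k(f_k)$ in $L^2$ with $f_k\in\mathfrak H^{\tilde\otimes k}$, $$\widetilde f_n^{\,r,c}=\sum_{k=n}^\infty\binom kn\,\mathbb I_r^{\otimes n}\big\langle f_k,c_r^{\otimes(k-n)}\big\rangle_{\mathfrak H^{\otimes(k-n)}},\qquad n\ge0,$$ where the series converges in $\mathfrak H^{\tilde\otimes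 n}$. Then $$D_r^c=\Big\{\xi=\sum_{k=0}^\infty I_k(f_k)\;:\;\sum_{k=0}^\infty k!\,\big\|\widetilde f_k^{\,r,c}\big\|^2_{\mathfrak H^{\otimes k}}<\infty\Big\}.$$ That is, every $\xi\in D_r^c$ has a chaos expansion, and a $\xi$ with chaos expansion $\xi=\sum_k I_k(f_k)$ belongs to $D_r^c$ if and only if $\sum_k k!\,\|\widetilde f_k^{\,r,c}\|^2<\infty$. Moreover, for $\xi\in D_r^c$ with chaos expansion $\xi=\sum_k I_k(f_k)$, $$\widetilde E^c[\xi\,|\,\mathcal F_r^X]=\sum_{k=0}^\infty I_k\big(\widetilde f_k^{\,r,c}\big)\quad\text{in }L^2.$$ -/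

import Mathlib

open MeasureTheory ProbabilityTheory UniformSpace
open scoped TensorProduct InnerProductSpace Nat

noncomputable section

/-! ### Hilbert space tensor powers -/

/-- The Hilbert space tensor product of two real inner product spaces: the completion of the
algebraic tensor product for `⟪x ⊗ y, x' ⊗ y'⟫ = ⟪x, x'⟫ * ⟪y, y'⟫`. -/
abbrev HilbertTensor (E F : Type*) [NormedAddCommGroup E] [InnerProductSpace ℝ E]
    [NormedAddCommGroup F] [InnerProductSpace ℝ F] : Type _ :=
  Completion (E ⊗[ℝ] F)

namespace HilbertTensor

variable (E F : Type*) [NormedAddCommGroup E] [InnerProductSpace ℝ E]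
  [NormedAddCommGroup F] [InnerProductSpace ℝ F]

/-- The continuous bilinear map `(x, y) ↦ x ⊗ y`. -/
def mk : E →L[ℝ] F →L[ℝ] HilbertTensor E F :=
  (ContinuousLinearMap.compL ℝ F (E ⊗[ℝ] F) (HilbertTensor E F) Completion.toComplL).comp
    (TensorProduct.mkL ℝ E F)

variable {E F}

/-- The continuous linear extension `A ⊗ B` of `x ⊗ y ↦ A x ⊗ B y`. -/
def map (A : E →L[ℝ] E) (B : F →L[ℝ] F) : HilbertTensor E F →L[ℝ] HilbertTensor E F :=
  (Completion.toComplL.comp (TensorProduct.mapL A B)).extend Completion.toComplL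

end HilbertTensor

/-- A bundled real Hilbert space, used only for the recursion defining tensor powers. -/
structure RealHilbertSpace where
  carrier : Type
  [normed : NormedAddCommGroup carrier]
  [innerProduct : InnerProductSpace ℝ carrier]
  [complete : CompleteSpace carrier]

attribute [instance] RealHilbertSpace.normed RealHilbertSpace.innerProduct
  RealHilbertSpace.complete

section TensorPower

variable (H : Type) [NormedAddCommGroup H] [InnerProductSpace ℝ H]

/-- The recursion `H^{⊗0} = ℝ`, `H^{⊗(n+1)} = H ⊗ H^{⊗n}` (Hilbert space tensor products). -/
def tensorPowerBundled : ℕ → RealHilbertSpace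
  | 0 => ⟨ℝ⟩
  | n + 1 => ⟨HilbertTensor H (tensorPowerBundled n).carrier⟩

/-- The Hilbert space tensor power `H^{⊗n}`, with its inner product
`⟪h₁ ⊗ ⋯ ⊗ hₙ, g₁ ⊗ ⋯ ⊗ gₙ⟫ = ∏ ⟪hᵢ, gᵢ⟫`. -/
abbrev TensorPow (n : ℕ) : Type := (tensorPowerBundled H n).carrier

variable {H}

namespace TensorPow

/-- The scalar `a`, as an element of `H^{⊗0} = ℝ`. -/
def ofReal (a : ℝ) : TensorPow H 0 := a

/-- An element of `H^{⊗0} = ℝ`, as a scalar. -/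
def toReal (a : TensorPow H 0) : ℝ := a

/-- The continuous bilinear map `(h, u) ↦ h ⊗ u` from `H × H^{⊗n}` to `H^{⊗(n+1)}`. -/
def cons (n : ℕ) : H →L[ℝ] TensorPow H n →L[ℝ] TensorPow H (n + 1) :=
  HilbertTensor.mk H (TensorPow H n)

/-- The power `h^{⊗n}`. -/
def pow (h : H) : (n : ℕ) → TensorPow H n
  | 0 => ofReal 1
  | n + 1 => cons n h (pow h n)

/-- The operator `A^{⊗n}` on `H^{⊗n}`, the identity for `n = 0`. -/
def map (A : H →L[ℝ] H) : (n : ℕ) → TensorPow H n →L[ℝ] TensorPow H n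
  | 0 => ContinuousLinearMap.id ℝ _
  | n + 1 => HilbertTensor.map A (map A n)

/-- The contraction of one tensor slot against `c`: the adjoint of `u ↦ c ⊗ u`, that is the
continuous linear extension of `h ⊗ u ↦ ⟪h, c⟫ • u`. -/
def contract (c : H) (n : ℕ) : TensorPow H (n + 1) →L[ℝ] TensorPow H n :=
  ContinuousLinearMap.adjoint (cons n c)

/-- The contraction `⟨f, c^{⊗j}⟩ ∈ H^{⊗n}` of `f ∈ H^{⊗(n+j)}`. It contracts the first `j` slots;
the choice of slots does not matter for symmetric `f`. -/
def contractPow (c : H) (n : ℕ) : (j : ℕ) → TensorPow H (n + j) →L[ℝ] TensorPow H n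
  | 0 => ContinuousLinearMap.id ℝ _
  | j + 1 => (contractPow c n j).comp (contract c (n + j))

variable (H) in
/-- The symmetric Hilbert space tensor power, as the closed subspace of `H^{⊗n}` generated by the
powers `h^{⊗n}`, `h ∈ H`. -/
def symmetric (n : ℕ) : Submodule ℝ (TensorPow H n) :=
  (Submodule.span ℝ (Set.range fun h : H => pow h n)).topologicalClosure

end TensorPow

end TensorPower

/-! ### Gaussian processes and their space of deterministic integrands -/

/-- A measurable centered Gaussian process `(X_t)`, `t ∈ [0, T]`, with `X_0 = 0`. -/
structure CenteredGaussianProc {Ω : Type*} [MeasurableSpace Ω] (P : Measure Ω) (T : ℝ) where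
  toFun : Set.Icc (0 : ℝ) T → Ω → ℝ
  measurable_uncurry : Measurable (Function.uncurry toFun)
  isGaussian : IsGaussianProcess toFun P
  centered : ∀ t, ∫ ω, toFun t ω ∂P = 0
  zero_ae : ∀ t : Set.Icc (0 : ℝ) T, (t : ℝ) = 0 → toFun t =ᵐ[P] 0

/-- The indicator function `1_{(0,t]}`. -/
def indIoc (t : ℝ) : ℝ → ℝ := Set.indicator (Set.Ioc 0 t) 1

/-- The indicators `1_{(0,t]}`, `t > 0`, are linearly independent, so that a function in their span
has unique coefficients. -/
theorem linearIndependent_indIoc (T : ℝ) :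
    LinearIndependent ℝ (fun t : Set.Ioc (0 : ℝ) T => indIoc t) := by
  rw [linearIndependent_iff]
  intro l hl
  by_contra hne
  have hs : l.support.Nonempty := Finsupp.support_nonempty_iff.mpr hne
  set m := l.support.max' hs with hm
  have hmem : m ∈ l.support := Finset.max'_mem _ _
  have h := congrFun hl (m : ℝ)
  rw [Finsupp.linearCombination_apply, Finsupp.sum, Finset.sum_apply,
    Finset.sum_eq_single_of_mem m hmem] at h
  · simp only [Pi.smul_apply, indIoc, smul_eq_mul, Pi.zero_apply] at h
    rw [Set.indicator_of_mem (by exact ⟨m.2.1, le_refl _⟩)] at h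
    simp only [Pi.one_apply, mul_one] at h
    exact (Finsupp.mem_support_iff.mp hmem) h
  · intro b hb hbm
    have hlt : b < m := lt_of_le_of_ne (Finset.le_max' _ _ hb) hbm
    simp only [Pi.smul_apply, indIoc, smul_eq_mul]
    rw [Set.indicator_of_notMem (fun hx => absurd hx.2 (not_le.mpr hlt)), mul_zero]

/-- The minimum `t ∧ r` in `[0, T]`. -/
def truncTime {T : ℝ} (t r : Set.Icc (0 : ℝ) T) : Set.Icc (0 : ℝ) T :=
  ⟨min (t : ℝ) r, le_min t.2.1 r.2.1, (min_le_left _ _).trans t.2.2⟩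

namespace CenteredGaussianProc

variable {Ω : Type*} [MeasurableSpace Ω] {P : Measure Ω} {T : ℝ}

theorem memLp (X : CenteredGaussianProc P T) (t : Set.Icc (0 : ℝ) T) :
    MemLp (X.toFun t) 2 P :=
  (X.isGaussian.hasGaussianLaw_eval t).memLp_two

/-- `X_t` as an element of `L²(P)`. -/
def val (X : CenteredGaussianProc P T) (t : Set.Icc (0 : ℝ) T) : Lp ℝ 2 P :=
  (X.memLp t).toLp (X.toFun t)

/-- The covariance function `R(t, s) = E[X_t X_s]`. -/
def cov (X : CenteredGaussianProc P T) (t s : Set.Icc (0 : ℝ) T) : ℝ :=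
  ∫ ω, X.toFun t ω * X.toFun s ω ∂P

/-- The `σ`-algebra `ℱ_T^X` generated by `X`. -/
abbrev sigmaAlgebra (X : CenteredGaussianProc P T) : MeasurableSpace Ω :=
  ⨆ t, MeasurableSpace.comap (X.toFun t) inferInstance

/-- `L²_X = L²(Ω, ℱ_T^X, P)`, as a subspace of `L²(P)`. -/
def L2X (X : CenteredGaussianProc P T) : Submodule ℝ (Lp ℝ 2 P) :=
  lpMeas ℝ ℝ X.sigmaAlgebra 2 P

/-- The linear span of the functions `1_{(0,t]}`, `t ∈ [0, T]` (for `t = 0` this function is `0`).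
It carries the inner product determined by `X`. -/
def StepFun (_X : CenteredGaussianProc P T) : Type :=
  Submodule.span ℝ (Set.range fun t : Set.Ioc (0 : ℝ) T => indIoc t)

variable (X : CenteredGaussianProc P T)

instance : AddCommGroup X.StepFun :=
  inferInstanceAs (AddCommGroup (Submodule.span ℝ (Set.range fun t : Set.Ioc (0 : ℝ) T => indIoc t)))

instance : Module ℝ X.StepFun :=
  inferInstanceAs (Module ℝ (Submodule.span ℝ (Set.range fun t : Set.Ioc (0 : ℝ) T => indIoc t)))

/-- The coefficients `a` of a step function `∑ a_t 1_{(0,t]}`. -/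
def coeffs : X.StepFun →ₗ[ℝ] (Set.Ioc (0 : ℝ) T →₀ ℝ) :=
  (linearIndependent_indIoc T).repr

/-- `1_{(0,t]}` as a step function. -/
def stepInd (t : Set.Icc (0 : ℝ) T) : X.StepFun :=
  ⟨indIoc t, by
    by_cases h : 0 < (t : ℝ)
    · exact Submodule.subset_span ⟨⟨t, h, t.2.2⟩, rfl⟩
    · have : indIoc t = 0 := by
        rw [indIoc, Set.Ioc_eq_empty h, Set.indicator_empty]
        rfl
      rw [this]
      exact Submodule.zero_mem _⟩

/-- A positive time, as an element of `[0, T]`. -/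
def toIcc (t : Set.Ioc (0 : ℝ) T) : Set.Icc (0 : ℝ) T := ⟨t, t.2.1.le, t.2.2⟩

/-- The elementary Wiener integral `∑ a_t 1_{(0,t]} ↦ ∑ a_t X_t`. -/
def stepIntegral : X.StepFun →ₗ[ℝ] Lp ℝ 2 P :=
  (Finsupp.linearCombination ℝ fun t => X.val (toIcc t)).comp X.coeffs

/-- The bilinear form with `⟨1_{(0,t]}, 1_{(0,s]}⟩ = R(t, s)`. -/
def stepInner (f g : X.StepFun) : ℝ :=
  (X.coeffs f).sum fun t a => (X.coeffs g).sum fun s b => a * b * X.cov (toIcc t) (toIcc s)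

theorem stepInner_eq (f g : X.StepFun) :
    X.stepInner f g = ⟪X.stepIntegral f, X.stepIntegral g⟫_ℝ := by
  have hcov : ∀ t s, X.cov t s = ⟪X.val t, X.val s⟫_ℝ := by
    intro t s
    rw [L2.inner_def, cov]
    refine integral_congr_ae ?_
    filter_upwards [(X.memLp t).coeFn_toLp, (X.memLp s).coeFn_toLp] with ω h1 h2
    simp only [val, h1, h2, RCLike.inner_apply, conj_trivial]
    ring
  simp only [stepInner, stepIntegral, LinearMap.comp_apply, Finsupp.linearCombination_apply,
    Finsupp.sum, sum_inner, inner_sum, real_inner_smul_left, real_inner_smul_right, hcov]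
  rw [Finset.sum_comm]
  refine Finset.sum_congr rfl fun s _ => Finset.sum_congr rfl fun t _ => ?_
  ring

/-- The inner product axioms (up to definiteness) for `stepInner`. -/
abbrev stepCore : PreInnerProductSpace.Core ℝ X.StepFun where
  inner := X.stepInner
  conj_inner_symm f g := by
    simp only [stepInner_eq, conj_trivial]
    exact real_inner_comm _ _
  re_inner_nonneg f := by
    simp only [stepInner_eq, RCLike.re_to_real]
    exact real_inner_self_nonneg
  add_left f g h := by simp only [stepInner_eq, map_add, inner_add_left]
  smul_left f g a := by simp only [stepInner_eq, map_smul, real_inner_smul_left, conj_trivial]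

instance : SeminormedAddCommGroup X.StepFun :=
  @InnerProductSpace.Core.toSeminormedAddCommGroup ℝ X.StepFun _ _ _ X.stepCore

instance : InnerProductSpace ℝ X.StepFun := InnerProductSpace.ofCore X.stepCore

/-- The space of deterministic integrands `ℌ_X`: the Hilbert space completion of the span of the
`1_{(0,t]}` for `⟨1_{(0,t]}, 1_{(0,s]}⟩ = R(t, s)` (step functions of norm `0` are identified
with `0`). -/
abbrev Integrands : Type := Completion X.StepFun

/-- `1_{(0,t]}` as an element of `ℌ_X`. -/
def ind (t : Set.Icc (0 : ℝ) T) : X.Integrands := (X.stepInd t : Completion X.StepFun)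

/-- The elementary Wiener integral as a linear isometry. -/
def stepIsometry : X.StepFun →ₗᵢ[ℝ] Lp ℝ 2 P where
  toLinearMap := X.stepIntegral
  norm_map' f := by
    have h : ⟪f, f⟫_ℝ = ⟪X.stepIntegral f, X.stepIntegral f⟫_ℝ := X.stepInner_eq f f
    rw [real_inner_self_eq_norm_sq, real_inner_self_eq_norm_sq] at h
    exact ((sq_eq_sq₀ (norm_nonneg _) (norm_nonneg _)).mp h).symm

/-- The Wiener integral `I`, the continuous linear extension of `1_{(0,t]} ↦ X_t` to `ℌ_X`. -/
def wienerIntegral : X.Integrands →L[ℝ] Lp ℝ 2 P :=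
  X.stepIsometry.toContinuousLinearMap.extend Completion.toComplL

/-- `X` has an indefinite Wiener integral: for every `r ∈ [0, T]` there is a continuous linear
operator on `ℌ_X` that maps `1_{(0,t]}` to `1_{(0,t ∧ r]}` for all `t ∈ [0, T]`. -/
def HasIndefiniteWienerIntegral : Prop :=
  ∀ r : Set.Icc (0 : ℝ) T, ∃ A : X.Integrands →L[ℝ] X.Integrands,
    ∀ t : Set.Icc (0 : ℝ) T, A (X.ind t) = X.ind (truncTime t r)

variable {X}

/-- The (unique) truncation operator `𝕀_r` on `ℌ_X`. -/
def HasIndefiniteWienerIntegral.trunc (hX : X.HasIndefiniteWienerIntegral)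
    (r : Set.Icc (0 : ℝ) T) : X.Integrands →L[ℝ] X.Integrands :=
  (hX r).choose

variable (X)

/-- The Wick exponential `exp(I(h) - E[I(h)²]/2)`. -/
def wickExp (h : X.Integrands) (ω : Ω) : ℝ :=
  Real.exp (X.wienerIntegral h ω - (1 / 2) * ∫ ω', (X.wienerIntegral h ω') ^ 2 ∂P)

/-- The `S`-transform `(Sξ)(h) = E[ξ exp(I(h) - E[I(h)²]/2)]`. -/
def sTransform (ξ : Lp ℝ 2 P) (h : X.Integrands) : ℝ :=
  ∫ ω, ξ ω * X.wickExp h ω ∂P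

/-! ### Shifted quasi-conditional expectation -/

variable {X}

/-- `η ∈ L²_X` is a `c`-shifted quasi-conditional expectation of `ξ` given `ℱ_r^X`:
`(Sξ)(𝕀_r^*(h + c) - c) = (Sη)(h)` for all `h ∈ ℌ_X`. -/
def IsShiftedQuasiCondExp (hX : X.HasIndefiniteWienerIntegral) (r : Set.Icc (0 : ℝ) T)
    (c : X.Integrands) (ξ η : Lp ℝ 2 P) : Prop :=
  η ∈ X.L2X ∧ ∀ h : X.Integrands,
    X.sTransform ξ (ContinuousLinearMap.adjoint (hX.trunc r) (h + c) - c) = X.sTransform η h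

/-- The domain `D_r^c`. -/
def quasiDomain (hX : X.HasIndefiniteWienerIntegral) (r : Set.Icc (0 : ℝ) T)
    (c : X.Integrands) : Set (Lp ℝ 2 P) :=
  {ξ | ξ ∈ X.L2X ∧ ∃ η, IsShiftedQuasiCondExp hX r c ξ η}

open Classical in
/-- The `c`-shifted quasi-conditional expectation of `ξ` given `ℱ_r^X`, for `ξ ∈ D_r^c`
(and `0` outside of `D_r^c`). -/
def quasiCondExp (hX : X.HasIndefiniteWienerIntegral) (r : Set.Icc (0 : ℝ) T)
    (c : X.Integrands) (ξ : Lp ℝ 2 P) : Lp ℝ 2 P :=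
  if hξ : ∃ η, IsShiftedQuasiCondExp hX r c ξ η then hξ.choose else 0

/-! ### Multiple Wiener integrals -/

variable (X)

/-- The closure in `ℌ^{⊗q} × L²(P)` of the linear span of the pairs `(h^{⊗q}, H_q(I(h)))` with
`‖h‖ = 1`, where `H_q` is the `q`th (monic, probabilists') Hermite polynomial. By
`E[H_q(I(h)) H_q(I(g))] = q! ⟪h, g⟫^q` it is, for `q ≥ 1`, the graph of a continuous linear map on
the symmetric tensor power. -/
def chaosGraph (q : ℕ) : Submodule ℝ (TensorPow X.Integrands q × Lp ℝ 2 P) :=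
  (Submodule.span ℝ {p : TensorPow X.Integrands q × Lp ℝ 2 P | ∃ h : X.Integrands, ‖h‖ = 1 ∧
    p.1 = TensorPow.pow h q ∧
    p.2 =ᵐ[P] fun ω => Polynomial.aeval (X.wienerIntegral h ω) (Polynomial.hermite q)
    }).topologicalClosure

open Classical in
/-- The multiple Wiener integral `I_q`: for `q = 0` the identity on `ℝ`, and for `q ≥ 1` the
continuous linear extension of `h^{⊗q} ↦ H_q(I(h))`, `‖h‖ = 1`, to the symmetric tensor power
(its value at a tensor which is not symmetric is `0`). -/
def multipleIntegral [IsProbabilityMeasure P] :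
    (q : ℕ) → TensorPow X.Integrands q → Lp ℝ 2 P
  | 0, a => Lp.const 2 P (TensorPow.toReal a)
  | q + 1, f => if hf : ∃ η, (f, η) ∈ X.chaosGraph (q + 1) then hf.choose else 0

/-- `ξ = ∑ I_k(f_k)` in `L²`, with symmetric `f_k ∈ ℌ^{⊗k}`. -/
def IsChaosExpansion [IsProbabilityMeasure P] (f : (k : ℕ) → TensorPow X.Integrands k)
    (ξ : Lp ℝ 2 P) : Prop :=
  (∀ k, f k ∈ TensorPow.symmetric X.Integrands k) ∧
    HasSum (fun k => X.multipleIntegral k (f k)) ξ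

variable {X}

/-- `c_r = 𝕀_r^* c - c`. -/
def shift (hX : X.HasIndefiniteWienerIntegral) (r : Set.Icc (0 : ℝ) T) (c : X.Integrands) :
    X.Integrands :=
  ContinuousLinearMap.adjoint (hX.trunc r) c - c

/-- The summand with index `k = n + j` of the series `∑_{k ≥ n}` for the `n`th new coefficient:
`C(k, n) 𝕀_r^{⊗n} ⟨f_k, c_r^{⊗(k-n)}⟩`. -/
def newCoeffTerm (hX : X.HasIndefiniteWienerIntegral) (r : Set.Icc (0 : ℝ) T) (c : X.Integrands)
    (f : (k : ℕ) → TensorPow X.Integrands k) (n j : ℕ) : TensorPow X.Integrands n :=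
  ((n + j).choose n : ℝ) •
    TensorPow.map (hX.trunc r) n (TensorPow.contractPow (shift hX r c) n j (f (n + j)))

/-- The new coefficients `∑_{k ≥ n} C(k, n) 𝕀_r^{⊗n} ⟨f_k, c_r^{⊗(k-n)}⟩`. -/
def newCoeff (hX : X.HasIndefiniteWienerIntegral) (r : Set.Icc (0 : ℝ) T) (c : X.Integrands)
    (f : (k : ℕ) → TensorPow X.Integrands k) (n : ℕ) : TensorPow X.Integrands n :=
  ∑' j, newCoeffTerm hX r c f n j

end CenteredGaussianProc

end

/-! The `S`-transform at `g` is the inner product with the Wick exponential of `g`, and this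
exponential pairs with a chaos component by `⟪g^{⊗k}, f_k⟫` (`inner_wickLp_multipleIntegral`). Hence
the `S`-transform of `ξ = ∑ I_k(f_k)` is the power series `∑ ⟪g^{⊗k}, f_k⟫`.

The shifted argument is `𝕀_r^* h + c_r`. Expanding `(𝕀_r^* h + c_r)^{⊗k}` by the binomial formula
(`inner_pow_add`), contracting the slots that contain `c_r` and moving `𝕀_r^*` back onto the tensor
(`inner_map_pow`) gives a double series. Regrouped by powers of `h`, it is `∑ ⟪h^{⊗n}, newCoeff n⟫`
(`hasSum_inner_newCoeff`). The rearrangement is legitimate because summability of `k! ‖f_k‖²` forces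
`∑ R^k ‖f_k‖ < ∞` for every `R`.

So `η` is a quasi-conditional expectation of `ξ` exactly when its own power series is this one.
Scaling `h` separates the degrees, and a symmetric tensor is determined by its pairings with powers,
so the coefficients of `η` are the new coefficients (`IsChaosExpansion.eq_of_hasSum`,
`isShiftedQuasiCondExp_iff`). Since `‖I_k f‖² = k! ‖f‖²` and different orders are orthogonal, such
an `η` exists iff the stated sum is finite.

The background rests on two facts. Wick exponentials are total in `L²_X`
(`eq_zero_of_inner_wickLp_eq_zero`), which gives uniqueness and, with the exponential series, the
chaos expansion. Gaussian integration by parts yields the Hermite inner products behind the isometry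
of `I_k`. -/

noncomputable section

/-! ### Hilbert tensor products of two spaces -/

namespace HilbertTensor

variable {E F : Type*} [NormedAddCommGroup E] [InnerProductSpace ℝ E]
  [NormedAddCommGroup F] [InnerProductSpace ℝ F]

theorem mk_apply (x : E) (y : F) : mk E F x y = ((x ⊗ₜ[ℝ] y : E ⊗[ℝ] F) : HilbertTensor E F) := rfl

theorem inner_mk (x x' : E) (y y' : F) :
    ⟪mk E F x y, mk E F x' y'⟫_ℝ = ⟪x, x'⟫_ℝ * ⟪y, y'⟫_ℝ := by
  rw [mk_apply, mk_apply, Completion.inner_coe, TensorProduct.inner_tmul]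

theorem map_mk (A : E →L[ℝ] E) (B : F →L[ℝ] F) (x : E) (y : F) :
    map A B (mk E F x y) = mk E F (A x) (B y) := by
  have := ContinuousLinearMap.extend_eq (e := (Completion.toComplL : E ⊗[ℝ] F →L[ℝ] _))
    (Completion.toComplL.comp (TensorProduct.mapL A B))
    Completion.denseRange_coe (Completion.isUniformInducing_coe _) (x ⊗ₜ[ℝ] y)
  exact this

theorem clm_ext {G : Type*} [NormedAddCommGroup G] [NormedSpace ℝ G]
    {L M : HilbertTensor E F →L[ℝ] G} (h : ∀ x y, L (mk E F x y) = M (mk E F x y)) : L = M := by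
  ext u
  induction u using Completion.induction_on with
  | hp => exact isClosed_eq L.continuous M.continuous
  | ih u =>
    induction u with
    | zero => rw [Completion.coe_zero, map_zero, map_zero]
    | tmul x y => exact h x y
    | add u v hu hv => rw [Completion.coe_add, map_add, map_add, hu, hv]

end HilbertTensor

/-! ### Tensor powers: pairings, contractions, symmetric tensors -/

namespace TensorPow

variable {H : Type} [NormedAddCommGroup H] [InnerProductSpace ℝ H]

theorem inner_cons (n : ℕ) (h g : H) (u v : TensorPow H n) :
    ⟪cons n h u, cons n g v⟫_ℝ = ⟪h, g⟫_ℝ * ⟪u, v⟫_ℝ :=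
  HilbertTensor.inner_mk h g u v

theorem norm_cons (n : ℕ) (h : H) (u : TensorPow H n) : ‖cons n h u‖ = ‖h‖ * ‖u‖ := by
  rw [← sq_eq_sq₀ (norm_nonneg _) (by positivity), ← real_inner_self_eq_norm_sq, inner_cons,
    real_inner_self_eq_norm_sq, real_inner_self_eq_norm_sq, mul_pow]

theorem clm_ext_cons {n : ℕ} {G : Type*} [NormedAddCommGroup G] [NormedSpace ℝ G]
    {L M : TensorPow H (n + 1) →L[ℝ] G} (h : ∀ x u, L (cons n x u) = M (cons n x u)) : L = M :=
  HilbertTensor.clm_ext h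

theorem inner_zero_eq (a b : TensorPow H 0) : ⟪a, b⟫_ℝ = toReal a * toReal b :=
  (real_inner_eq_re_inner ℝ (toReal a) (toReal b)).trans (mul_comm _ _)

theorem inner_pow (h g : H) (n : ℕ) : ⟪pow h n, pow g n⟫_ℝ = ⟪h, g⟫_ℝ ^ n := by
  induction n with
  | zero => rw [inner_zero_eq]; simp [pow, toReal, ofReal]
  | succ n ih => rw [pow, pow, inner_cons, ih, pow_succ']

theorem norm_pow (h : H) (n : ℕ) : ‖pow h n‖ = ‖h‖ ^ n := by
  rw [← sq_eq_sq₀ (norm_nonneg _) (by positivity), ← real_inner_self_eq_norm_sq, inner_pow,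
    real_inner_self_eq_norm_sq, ← pow_mul, ← pow_mul, mul_comm]

theorem pow_smul (a : ℝ) (h : H) (n : ℕ) : pow (a • h) n = a ^ n • pow h n := by
  induction n with
  | zero => simp [pow]
  | succ n ih =>
    rw [pow, pow, ih, map_smul, map_smul, smul_apply, smul_smul, pow_succ]

theorem map_cons (A : H →L[ℝ] H) (n : ℕ) (x : H) (u : TensorPow H n) :
    map A (n + 1) (cons n x u) = cons n (A x) (map A n u) :=
  HilbertTensor.map_mk A (map A n) x u

theorem map_pow (A : H →L[ℝ] H) (h : H) (n : ℕ) : map A n (pow h n) = pow (A h) n := by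
  induction n with
  | zero => rfl
  | succ n ih => rw [pow, map_cons, ih, pow]

/-- The adjoint of `A^{⊗n}` is `(A^*)^{⊗n}`, of which only the action on powers is needed. This
transfers `𝕀_r^{⊗n}` in a coefficient to `𝕀_r^*` in the argument of the `S`-transform. -/
theorem inner_map_pow [CompleteSpace H] (A : H →L[ℝ] H) (n : ℕ) (u : TensorPow H n) (h : H) :
    ⟪map A n u, pow h n⟫_ℝ = ⟪u, pow (ContinuousLinearMap.adjoint A h) n⟫_ℝ := by
  induction n with
  | zero => rfl
  | succ n ih =>
    have key : (innerSL ℝ (pow h (n + 1))).comp (map A (n + 1)) =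
        innerSL ℝ (pow (ContinuousLinearMap.adjoint A h) (n + 1)) := by
      refine clm_ext_cons fun x v => ?_
      simp only [ContinuousLinearMap.comp_apply, innerSL_apply_apply]
      rw [map_cons, pow, pow, inner_cons, inner_cons, ContinuousLinearMap.adjoint_inner_left,
        real_inner_comm _ (pow h n), ih, real_inner_comm v]
    have := congrArg (fun L => L u) key
    simp only [ContinuousLinearMap.comp_apply, innerSL_apply_apply] at this
    rw [real_inner_comm, this, real_inner_comm]

theorem inner_contract (c : H) (n : ℕ) (f : TensorPow H (n + 1)) (u : TensorPow H n) :
    ⟪contract c n f, u⟫_ℝ = ⟪f, cons n c u⟫_ℝ :=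
  ContinuousLinearMap.adjoint_inner_left _ _ _

theorem contract_cons (c h : H) (n : ℕ) (u : TensorPow H n) :
    contract c n (cons n h u) = ⟪h, c⟫_ℝ • u := by
  refine ext_inner_right ℝ fun v => ?_
  rw [inner_contract, inner_cons, real_inner_smul_left]

theorem norm_contract_le (c : H) (n : ℕ) (f : TensorPow H (n + 1)) :
    ‖contract c n f‖ ≤ ‖c‖ * ‖f‖ := by
  refine (contract c n).le_of_opNorm_le ?_ f
  rw [contract, LinearIsometryEquiv.norm_map]
  exact ContinuousLinearMap.opNorm_le_bound _ (norm_nonneg _) fun u => (norm_cons n c u).le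

theorem norm_contractPow_le (c : H) (n j : ℕ) (f : TensorPow H (n + j)) :
    ‖contractPow c n j f‖ ≤ ‖c‖ ^ j * ‖f‖ := by
  induction j with
  | zero => simp [contractPow]
  | succ j ih =>
    calc ‖contractPow c n (j + 1) f‖ ≤ ‖c‖ ^ j * ‖contract c (n + j) f‖ := ih _
      _ ≤ ‖c‖ ^ j * (‖c‖ * ‖f‖) := by gcongr; exact norm_contract_le c (n + j) f
      _ = _ := by ring

theorem contract_pow (c h : H) (n : ℕ) : contract c n (pow h (n + 1)) = ⟪h, c⟫_ℝ • pow h n := by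
  rw [pow, contract_cons]

theorem contractPow_pow (c h : H) (n j : ℕ) :
    contractPow c n j (pow h (n + j)) = ⟪h, c⟫_ℝ ^ j • pow h n := by
  induction j with
  | zero => simp [contractPow]
  | succ j ih =>
    -- The indices `n + (j + 1)` and `n + j + 1` agree definitionally, so no cast is needed.
    change contractPow c n j (contract c (n + j) (pow h (n + j + 1))) = _
    rw [contract_pow, map_smul, ih, smul_smul, pow_succ']

theorem pow_mem_symmetric (h : H) (n : ℕ) : pow h n ∈ symmetric H n :=
  Submodule.le_topologicalClosure _ (Submodule.subset_span ⟨h, rfl⟩)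

theorem isClosed_symmetric (n : ℕ) : IsClosed (symmetric H n : Set (TensorPow H n)) :=
  Submodule.isClosed_topologicalClosure _

/-- Induction principle for symmetric tensors: a closed linear condition need only be checked on
powers, which span a dense subspace. -/
theorem apply_mem_of_mem_symmetric {n : ℕ} {G : Type*} [NormedAddCommGroup G] [NormedSpace ℝ G]
    (L : TensorPow H n →L[ℝ] G) {K : Submodule ℝ G} (hK : IsClosed (K : Set G))
    (hL : ∀ h, L (pow h n) ∈ K) {f : TensorPow H n} (hf : f ∈ symmetric H n) : L f ∈ K := by
  have hle : symmetric H n ≤ K.comap L.toLinearMap := by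
    refine Submodule.topologicalClosure_minimal _ ?_ (hK.preimage L.continuous)
    rw [Submodule.span_le]
    rintro _ ⟨h, rfl⟩
    exact hL h
  exact hle hf

theorem clm_eq_of_mem_symmetric {n : ℕ} {G : Type*} [NormedAddCommGroup G] [NormedSpace ℝ G]
    {L M : TensorPow H n →L[ℝ] G} (h : ∀ x, L (pow x n) = M (pow x n)) {f : TensorPow H n}
    (hf : f ∈ symmetric H n) : L f = M f := by
  have := apply_mem_of_mem_symmetric (L - M) (K := ⊥) isClosed_singleton
    (fun x => by simp [h]) hf
  simpa [sub_eq_zero] using this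

/-- Takes the place of polarisation: orthogonality to all powers extends to their closed span, so
`f` is orthogonal to itself. -/
theorem eq_zero_of_mem_symmetric {n : ℕ} {f : TensorPow H n} (hf : f ∈ symmetric H n)
    (h : ∀ x, ⟪f, pow x n⟫_ℝ = 0) : f = 0 := by
  have := clm_eq_of_mem_symmetric (L := innerSL ℝ f) (M := 0) (fun x => by simpa using h x) hf
  simpa using this

theorem map_mem_symmetric (A : H →L[ℝ] H) {n : ℕ} {f : TensorPow H n} (hf : f ∈ symmetric H n) :
    map A n f ∈ symmetric H n :=
  apply_mem_of_mem_symmetric _ (isClosed_symmetric n)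
    (fun h => by rw [map_pow]; exact pow_mem_symmetric _ _) hf

theorem contractPow_mem_symmetric (c : H) (n j : ℕ) {f : TensorPow H (n + j)}
    (hf : f ∈ symmetric H (n + j)) : contractPow c n j f ∈ symmetric H n :=
  apply_mem_of_mem_symmetric _ (isClosed_symmetric n)
    (fun h => by
      rw [contractPow_pow]
      exact Submodule.smul_mem _ _ (pow_mem_symmetric _ _)) hf

/-- The binomial formula for the pairing of a symmetric tensor with `(a + b)^{⊗k}`. -/
theorem inner_pow_add (a b : H) (k : ℕ) (f : (k : ℕ) → TensorPow H k)
    (hf : f k ∈ symmetric H k) :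
    ⟪f k, pow (a + b) k⟫_ℝ = ∑ p ∈ Finset.HasAntidiagonal.antidiagonal k,
      ((p.1 + p.2).choose p.1 : ℝ) * ⟪contractPow b p.1 p.2 (f (p.1 + p.2)), pow a p.1⟫_ℝ := by
  -- `p.1 + p.2 = k` is only propositional, so the summands live in different types. Embedding `f k`
  -- into the family of all orders and projecting to order `p.1 + p.2` makes each summand a
  -- continuous linear function of `f k` without casts.
  have hsingle : ∀ (g : (k : ℕ) → TensorPow H k), ∀ p ∈ Finset.HasAntidiagonal.antidiagonal k,
      (Pi.single k (g k) : (k : ℕ) → TensorPow H k) (p.1 + p.2) = g (p.1 + p.2) := by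
    intro g p hp
    rw [Finset.HasAntidiagonal.mem_antidiagonal] at hp
    subst hp
    simp
  let M : TensorPow H k →L[ℝ] ℝ := ∑ p ∈ Finset.HasAntidiagonal.antidiagonal k,
      ((p.1 + p.2).choose p.1 : ℝ) • ((innerSL ℝ (pow a p.1)).comp
        ((contractPow b p.1 p.2).comp ((ContinuousLinearMap.proj (p.1 + p.2)).comp
          (ContinuousLinearMap.single ℝ (fun k => TensorPow H k) k))))
  have hM : ∀ g : (k : ℕ) → TensorPow H k, M (g k) = ∑ p ∈ Finset.HasAntidiagonal.antidiagonal k,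
      ((p.1 + p.2).choose p.1 : ℝ) * ⟪contractPow b p.1 p.2 (g (p.1 + p.2)), pow a p.1⟫_ℝ := by
    intro g
    simp only [M, sum_apply, smul_apply,
      ContinuousLinearMap.comp_apply, innerSL_apply_apply, smul_eq_mul,
      ContinuousLinearMap.proj_apply, ContinuousLinearMap.single_apply]
    refine Finset.sum_congr rfl fun p hp => ?_
    rw [hsingle g p hp, real_inner_comm]
  rw [← hM, real_inner_comm, ← innerSL_apply_apply ℝ]
  -- Both sides are continuous and linear in `f k`; on a power `x^{⊗k}` the claim is the binomial
  -- theorem for `⟪x, a⟫ + ⟪x, b⟫`.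
  refine clm_eq_of_mem_symmetric (fun x => ?_) hf
  rw [hM (fun k => pow x k), innerSL_apply_apply, inner_pow, inner_add_left, add_pow,
    Finset.Nat.sum_antidiagonal_eq_sum_range_succ_mk]
  refine Finset.sum_congr rfl fun m hm => ?_
  have hmk : m + (k - m) = k := by
    have := Finset.mem_range.mp hm
    omega
  rw [contractPow_pow, real_inner_smul_left, inner_pow, hmk, real_inner_comm x a,
    real_inner_comm x b]
  ring

end TensorPow

/-! ### Hermite polynomials under the standard Gaussian law -/

section Hermite

open Polynomial

theorem derivative_hermite_succ (n : ℕ) :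
    derivative (hermite (n + 1)) = ((n : ℤ[X]) + 1) * hermite n := by
  induction n with
  | zero => simp
  | succ n ih =>
    rw [hermite_succ (n + 1), derivative_sub, derivative_mul, derivative_X, ih, derivative_mul,
      hermite_succ n]
    simp only [derivative_add, derivative_natCast, derivative_one]
    push_cast
    ring

/-- The Hermite polynomials with real coefficients. -/
def hermiteReal (n : ℕ) : ℝ[X] := (hermite n).map (algebraMap ℤ ℝ)

theorem aeval_hermite (n : ℕ) (x : ℝ) : aeval x (hermite n) = (hermiteReal n).eval x := by
  rw [hermiteReal, eval_map_algebraMap]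

theorem hermiteReal_zero : hermiteReal 0 = 1 := by simp [hermiteReal]

theorem hermiteReal_succ (n : ℕ) :
    hermiteReal (n + 1) = X * hermiteReal n - derivative (hermiteReal n) := by
  simp [hermiteReal, hermite_succ, derivative_map]

theorem derivative_hermiteReal_succ (n : ℕ) :
    derivative (hermiteReal (n + 1)) = ((n : ℝ[X]) + 1) * hermiteReal n := by
  rw [hermiteReal, derivative_map, derivative_hermite_succ]
  simp [hermiteReal]

theorem integrable_eval_mul_exp_gaussianReal (p : ℝ[X]) (ρ m : ℝ) (v : NNReal) :
    Integrable (fun x => p.eval x * Real.exp (ρ * x)) (gaussianReal m v) := by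
  induction p using Polynomial.induction_on' with
  | add p q hp hq =>
    simp only [eval_add, add_mul]
    exact hp.add hq
  | monomial n a =>
    simp only [eval_monomial, mul_assoc]
    refine Integrable.const_mul ?_ a
    have : ρ ∈ interior (integrableExpSet id (gaussianReal m v)) := by
      rw [integrableExpSet_id_gaussianReal, interior_univ]
      trivial
    exact integrable_pow_mul_exp_of_mem_interior_integrableExpSet this n

theorem integrable_eval_gaussianReal (p : ℝ[X]) (m : ℝ) (v : NNReal) :
    Integrable (fun x => p.eval x) (gaussianReal m v) := by
  simpa using integrable_eval_mul_exp_gaussianReal p 0 m v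

theorem hasDerivAt_gaussianPDFReal (x : ℝ) :
    HasDerivAt (gaussianPDFReal 0 1) (-x * gaussianPDFReal 0 1 x) x := by
  have h : HasDerivAt (fun y : ℝ => -(y - 0) ^ 2 / (2 * ((1 : NNReal) : ℝ))) (-x) x := by
    have := (((hasDerivAt_id x).sub_const 0).pow 2).neg.div_const (2 * ((1 : NNReal) : ℝ))
    refine this.congr_deriv ?_
    simp
    ring
  refine (h.exp.const_mul _).congr_deriv ?_
  simp only [gaussianPDFReal]
  ring

/-- Gaussian integration by parts for `p(x) exp(ρ x)`. -/
theorem integral_X_mul_gaussianReal (p : ℝ[X]) (ρ : ℝ) :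
    ∫ x, (X * p).eval x * Real.exp (ρ * x) ∂gaussianReal 0 1 =
      ∫ x, (derivative p + C ρ * p).eval x * Real.exp (ρ * x) ∂gaussianReal 0 1 := by
  have hint : ∀ q : ℝ[X],
      Integrable (fun x => gaussianPDFReal 0 1 x • (q.eval x * Real.exp (ρ * x))) := by
    intro q
    have := integrable_eval_mul_exp_gaussianReal q ρ 0 1
    rw [gaussianReal_of_var_ne_zero _ one_ne_zero] at this
    rw [integrable_withDensity_iff_integrable_smul' (measurable_gaussianPDF 0 1)
      (ae_of_all _ fun x => gaussianPDF_lt_top)] at this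
    simpa [toReal_gaussianPDF] using this
  -- The integrand is the derivative of `φ(x) p(x) exp(ρ x)`, where the density satisfies `φ' = -x
  -- φ`; its integral over the line vanishes.
  have hzero : ∫ x, (gaussianPDFReal 0 1 x • ((derivative p + C ρ * p).eval x * Real.exp (ρ * x)) -
      gaussianPDFReal 0 1 x • ((X * p).eval x * Real.exp (ρ * x))) = 0 := by
    refine integral_eq_zero_of_hasDerivAt_of_integrable
      (f := fun x => gaussianPDFReal 0 1 x • (p.eval x * Real.exp (ρ * x))) (fun x => ?_)
      ((hint _).sub (hint _)) (hint p)
    have hexp : HasDerivAt (fun y : ℝ => Real.exp (ρ * y)) (Real.exp (ρ * x) * ρ) x := by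
      have := ((hasDerivAt_id x).const_mul ρ).exp
      simpa using this
    refine ((hasDerivAt_gaussianPDFReal x).mul ((p.hasDerivAt x).mul hexp)).congr_deriv ?_
    simp only [eval_add, eval_mul, eval_C, eval_X, smul_eq_mul, Pi.mul_apply]
    ring
  rw [integral_sub (hint _) (hint _), sub_eq_zero] at hzero
  rw [integral_gaussianReal_eq_integral_smul one_ne_zero,
    integral_gaussianReal_eq_integral_smul one_ne_zero]
  exact hzero.symm

/-- The raising operator `p ↦ X p - p'` is adjoint to differentiation under the Gaussian law; the
weight `exp(ρ x)` adds `ρ` to the derivative. -/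
theorem integral_hermiteReal_succ_mul (n : ℕ) (q : ℝ[X]) (ρ : ℝ) :
    ∫ x, (hermiteReal (n + 1) * q).eval x * Real.exp (ρ * x) ∂gaussianReal 0 1 =
      ∫ x, (hermiteReal n * (derivative q + C ρ * q)).eval x * Real.exp (ρ * x)
        ∂gaussianReal 0 1 := by
  have h := integral_X_mul_gaussianReal (hermiteReal n * q) ρ
  have hint := fun r : ℝ[X] => integrable_eval_mul_exp_gaussianReal r ρ 0 1
  have e1 : hermiteReal (n + 1) * q =
      X * (hermiteReal n * q) - derivative (hermiteReal n) * q := by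
    rw [hermiteReal_succ]
    ring
  have e2 : derivative (hermiteReal n * q) + C ρ * (hermiteReal n * q) =
      hermiteReal n * (derivative q + C ρ * q) + derivative (hermiteReal n) * q := by
    rw [derivative_mul]
    ring
  rw [e2] at h
  simp only [e1, eval_sub, sub_mul]
  rw [integral_sub (hint _) (hint _), h]
  simp only [eval_add, add_mul] at *
  rw [integral_add (by simpa [mul_add, add_mul] using (hint (hermiteReal n *
    (derivative q + C ρ * q)))) (hint _), add_sub_cancel_right]

theorem integral_hermiteReal_mul_exp (n : ℕ) (ρ : ℝ) :
    ∫ x, (hermiteReal n).eval x * Real.exp (ρ * x) ∂gaussianReal 0 1 =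
      ρ ^ n * Real.exp (ρ ^ 2 / 2) := by
  induction n with
  | zero =>
    have := congrFun (mgf_id_gaussianReal (μ := 0) (v := 1)) ρ
    simpa [hermiteReal_zero, mgf] using this
  | succ n ih =>
    have := integral_hermiteReal_succ_mul n 1 ρ
    rw [mul_one] at this
    rw [this]
    have e : ∀ x, (hermiteReal n * (derivative 1 + C ρ * 1)).eval x * Real.exp (ρ * x) =
        ρ * ((hermiteReal n).eval x * Real.exp (ρ * x)) := fun x => by
      simp
      ring
    simp only [e]
    rw [integral_const_mul, ih]
    ring

theorem integral_hermiteReal_succ (n : ℕ) :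
    ∫ x, (hermiteReal (n + 1)).eval x ∂gaussianReal 0 1 = 0 := by
  simpa using integral_hermiteReal_mul_exp (n + 1) 0

/-- Integration by parts with weight exponent `0` lowers the first degree; the chain rule and
`H_{n+1}' = (n+1) H_n` lower the second and produce the factor. -/
theorem integral_hermiteReal_mul_hermiteReal_comp (m n : ℕ) (ρ v : ℝ) :
    ∫ u, (hermiteReal (m + 1)).eval u * (hermiteReal (n + 1)).eval (ρ * u + v) ∂gaussianReal 0 1 =
      (n + 1) * ρ * ∫ u, (hermiteReal m).eval u * (hermiteReal n).eval (ρ * u + v)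
        ∂gaussianReal 0 1 := by
  have h := integral_hermiteReal_succ_mul m ((hermiteReal (n + 1)).comp (C ρ * X + C v)) 0
  simp only [zero_mul, Real.exp_zero, mul_one, eval_mul, eval_comp, eval_add, eval_C, eval_X] at h
  rw [h, ← integral_const_mul]
  refine integral_congr_ae (ae_of_all _ fun u => ?_)
  simp [derivative_comp, derivative_hermiteReal_succ]
  ring

end Hermite

/-! ### Hermite polynomials of two correlated Gaussian variables -/

section HermiteProduct

variable {Ω : Type*} [MeasurableSpace Ω] {P : Measure Ω} [IsProbabilityMeasure P]

omit [IsProbabilityMeasure P] in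
theorem memLp_eval_of_map_eq_gaussianReal {U : Ω → ℝ} (hU : AEMeasurable U P) {m : ℝ} {v : NNReal}
    (h : P.map U = gaussianReal m v) (p : Polynomial ℝ) :
    MemLp (fun ω => p.eval (U ω)) 2 P := by
  rw [memLp_two_iff_integrable_sq (by
    exact (p.continuous.measurable.comp_aemeasurable hU).aestronglyMeasurable)]
  have := integrable_eval_gaussianReal (p ^ 2) m v
  rw [← h] at this
  simpa [Function.comp_def] using this.comp_aemeasurable hU

/-- The inner product of two Hermite polynomials of correlated standard Gaussian variables. -/
theorem integral_hermiteReal_mul_hermiteReal {U V : Ω → ℝ} (hU : AEMeasurable U P)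
    (hV : AEMeasurable V P) (hUV : IndepFun U V P) (ρ : ℝ) (lU : P.map U = gaussianReal 0 1)
    (lV : P.map (fun ω => ρ * U ω + V ω) = gaussianReal 0 1) (m n : ℕ) :
    ∫ ω, (hermiteReal m).eval (U ω) * (hermiteReal n).eval (ρ * U ω + V ω) ∂P =
      if m = n then (n ! : ℝ) * ρ ^ n else 0 := by
  have hprod := (indepFun_iff_map_prod_eq_prod_map_map hU hV).mp hUV
  have hint : ∀ m n, Integrable (fun ω => (hermiteReal m).eval (U ω) *
      (hermiteReal n).eval (ρ * U ω + V ω)) P := fun m n =>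
    (memLp_eval_of_map_eq_gaussianReal hU lU _).integrable_mul
      (memLp_eval_of_map_eq_gaussianReal (by fun_prop) lV _)
  have hcont : ∀ m n, Continuous fun z : ℝ × ℝ => (hermiteReal m).eval z.1 *
      (hermiteReal n).eval (ρ * z.1 + z.2) := fun m n => by fun_prop
  have := Measure.isProbabilityMeasure_map (μ := P) hV
  -- Independence makes the joint law a product, so the integral over `u` can be taken first with
  -- `v` frozen.
  have hfub : ∀ m n, ∫ ω, (hermiteReal m).eval (U ω) * (hermiteReal n).eval (ρ * U ω + V ω) ∂P =
      ∫ v, ∫ u, (hermiteReal m).eval u * (hermiteReal n).eval (ρ * u + v) ∂gaussianReal 0 1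
        ∂(P.map V) := by
    intro m n
    have hint' : Integrable (fun z : ℝ × ℝ => (hermiteReal m).eval z.1 *
        (hermiteReal n).eval (ρ * z.1 + z.2)) ((gaussianReal 0 1).prod (P.map V)) := by
      rw [← lU, ← hprod, integrable_map_measure (hcont m n).aestronglyMeasurable (by fun_prop)]
      exact hint m n
    rw [← integral_prod_symm _ hint', ← lU, ← hprod,
      integral_map (by fun_prop) (hcont m n).aestronglyMeasurable]
  induction m generalizing n with
  | zero =>
    cases n with
    | zero => simp [hermiteReal_zero]
    | succ n =>
      have := integral_map (show AEMeasurable (fun ω => ρ * U ω + V ω) P by fun_prop)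
        (f := fun x => (hermiteReal (n + 1)).eval x)
        (hermiteReal (n + 1)).continuous.aestronglyMeasurable
      rw [lV, integral_hermiteReal_succ] at this
      simpa [hermiteReal_zero] using this.symm
  | succ m ih =>
    cases n with
    | zero =>
      have := integral_map hU
        (f := fun x => (hermiteReal (m + 1)).eval x)
        (hermiteReal (m + 1)).continuous.aestronglyMeasurable
      rw [lU, integral_hermiteReal_succ] at this
      simpa [hermiteReal_zero] using this.symm
    | succ n =>
      -- Both degrees drop inside the `u`-integral; Fubini is then reversed so that the induction
      -- hypothesis applies on `Ω`.
      rw [hfub]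
      simp only [integral_hermiteReal_mul_hermiteReal_comp]
      rw [integral_const_mul, ← hfub, ih]
      by_cases hmn : m = n
      · simp only [hmn, if_true, Nat.factorial_succ]
        push_cast
        ring
      · simp [hmn]

end HermiteProduct

/-! ### Continuity of the characteristic functional on `L²` -/

section L2Charfun

variable {Ω : Type*} [MeasurableSpace Ω] {P : Measure Ω} [IsProbabilityMeasure P]

theorem integral_norm_le_norm_L2 (u : Lp ℝ 2 P) : ∫ ω, ‖u ω‖ ∂P ≤ ‖u‖ := by
  rw [integral_norm_eq_lintegral_enorm (Lp.aestronglyMeasurable u), Lp.norm_def,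
    ← eLpNorm_one_eq_lintegral_enorm]
  refine ENNReal.toReal_mono (Lp.eLpNorm_ne_top u) ?_
  exact eLpNorm_le_eLpNorm_of_exponent_le (by norm_num) (Lp.aestronglyMeasurable u)

theorem norm_exp_mul_I_sub_exp_mul_I_le (x y : ℝ) :
    ‖Complex.exp (x * Complex.I) - Complex.exp (y * Complex.I)‖ ≤ ‖x - y‖ := by
  have h : Complex.exp (x * Complex.I) - Complex.exp (y * Complex.I) =
      Complex.exp (y * Complex.I) * (Complex.exp (Complex.I * ((x - y : ℝ) : ℂ)) - 1) := by
    rw [mul_sub, ← Complex.exp_add, mul_one]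
    congr 2
    push_cast
    ring
  rw [h, norm_mul, Complex.norm_exp_ofReal_mul_I, one_mul]
  exact Real.norm_exp_I_mul_ofReal_sub_one_le

/-- The map `x ↦ exp(ix)` is 1-Lipschitz and the `L¹` norm is at most the `L²` norm. This carries
Gaussianity from step functions to their `L²` limits. -/
theorem continuous_integral_exp_mul_I :
    Continuous fun u : Lp ℝ 2 P => ∫ ω, Complex.exp (u ω * Complex.I) ∂P := by
  have hint : ∀ u : Lp ℝ 2 P, Integrable (fun ω => Complex.exp (u ω * Complex.I)) P := fun u => by
    refine Integrable.of_bound (C := 1) ?_ (ae_of_all _ fun ω => ?_)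
    · exact (Continuous.comp_aestronglyMeasurable (g := fun x : ℝ => Complex.exp (x * Complex.I))
        (by fun_prop) (Lp.aestronglyMeasurable u))
    · rw [Complex.norm_exp_ofReal_mul_I]
  refine LipschitzWith.continuous (K := 1) (LipschitzWith.of_dist_le_mul fun u v => ?_)
  rw [dist_eq_norm, dist_eq_norm, ← integral_sub (hint u) (hint v), NNReal.coe_one, one_mul]
  calc ‖∫ ω, (Complex.exp (u ω * Complex.I) - Complex.exp (v ω * Complex.I)) ∂P‖
      ≤ ∫ ω, ‖(u - v) ω‖ ∂P := by
        refine norm_integral_le_of_norm_le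
          ((Lp.memLp (u - v)).integrable (by norm_num)).norm ?_
        filter_upwards [Lp.coeFn_sub u v] with ω hω
        rw [hω]
        exact norm_exp_mul_I_sub_exp_mul_I_le _ _
    _ ≤ ‖u - v‖ := integral_norm_le_norm_L2 _

end L2Charfun

/-! ### Laws of Wiener integrals and Wick exponentials -/

namespace CenteredGaussianProc

variable {Ω : Type*} [MeasurableSpace Ω] {P : Measure Ω} {T : ℝ} (X : CenteredGaussianProc P T)

theorem wienerIntegral_coe (f : X.StepFun) :
    X.wienerIntegral (f : Completion X.StepFun) = X.stepIntegral f :=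
  ContinuousLinearMap.extend_eq (e := (Completion.toComplL : X.StepFun →L[ℝ] _))
    X.stepIsometry.toContinuousLinearMap Completion.denseRange_coe
    (Completion.isUniformInducing_coe _) f

theorem norm_wienerIntegral (h : X.Integrands) : ‖X.wienerIntegral h‖ = ‖h‖ := by
  induction h using Completion.induction_on with
  | hp => exact isClosed_eq X.wienerIntegral.continuous.norm continuous_norm
  | ih f => rw [wienerIntegral_coe, Completion.norm_coe]; exact X.stepIsometry.norm_map f

theorem inner_wienerIntegral (h g : X.Integrands) :
    ⟪X.wienerIntegral h, X.wienerIntegral g⟫_ℝ = ⟪h, g⟫_ℝ := by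
  rw [real_inner_eq_norm_mul_self_add_norm_mul_self_sub_norm_sub_mul_self_div_two,
    real_inner_eq_norm_mul_self_add_norm_mul_self_sub_norm_sub_mul_self_div_two, ← map_sub]
  simp only [norm_wienerIntegral]

theorem integral_wienerIntegral_sq (h : X.Integrands) :
    ∫ ω, (X.wienerIntegral h ω) ^ 2 ∂P = ‖h‖ ^ 2 := by
  have := X.inner_wienerIntegral h h
  rw [L2.inner_def] at this
  rw [← real_inner_self_eq_norm_sq, ← this]
  refine integral_congr_ae (ae_of_all _ fun ω => ?_)
  simp [sq]

theorem stepIntegral_ae (f : X.StepFun) :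
    X.stepIntegral f =ᵐ[P]
      fun ω => ∑ t ∈ (X.coeffs f).support, X.coeffs f t • X.toFun (toIcc t) ω := by
  have h : X.stepIntegral f =
      ∑ t ∈ (X.coeffs f).support, X.coeffs f t • X.val (toIcc t) := rfl
  rw [h]
  refine (Lp.coeFn_finsetSum _ _).trans ?_
  have : ∀ t ∈ (X.coeffs f).support, (X.coeffs f t • X.val (toIcc t) : Lp ℝ 2 P) =ᵐ[P]
      fun ω => X.coeffs f t • X.toFun (toIcc t) ω := fun t _ => by
    filter_upwards [Lp.coeFn_smul (X.coeffs f t) (X.val (toIcc t)),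
      (X.memLp (toIcc t)).coeFn_toLp] with ω h1 h2
    rw [h1, Pi.smul_apply, val, h2]
  have := (Filter.eventually_all_finset _).mpr this
  filter_upwards [this] with ω hω
  rw [Finset.sum_apply]
  exact Finset.sum_congr rfl hω

theorem aemeasurable_wienerIntegral (h : X.Integrands) : AEMeasurable (X.wienerIntegral h) P :=
  (Lp.aestronglyMeasurable _).aemeasurable

theorem map_stepIntegral (f : X.StepFun) :
    P.map (X.stepIntegral f) = gaussianReal 0 (‖f‖ ^ 2).toNNReal := by
  have hg : HasGaussianLaw (X.stepIntegral f) P := by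
    refine HasGaussianLaw.congr ?_ (X.stepIntegral_ae f).symm
    exact ((X.isGaussian.comp_right toIcc).smul (X.coeffs f)).hasGaussianLaw_fun_sum
  have hmean : ∫ ω, X.stepIntegral f ω ∂P = 0 := by
    rw [integral_congr_ae (X.stepIntegral_ae f), integral_finsetSum]
    · refine Finset.sum_eq_zero fun t _ => ?_
      rw [integral_smul, X.centered, smul_zero]
    · intro t _
      exact ((X.isGaussian.hasGaussianLaw_eval (toIcc t)).integrable).smul (X.coeffs f t)
  rw [hg.map_eq_gaussianReal, hmean, variance_of_integral_eq_zero hg.aemeasurable hmean,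
    ← wienerIntegral_coe, integral_wienerIntegral_sq, Completion.norm_coe]

variable [IsProbabilityMeasure P]

/-- Both sides are continuous in `h`, and for step functions the integral is a Gaussian
characteristic function at `1`. The single argument `1` suffices because `h` may be rescaled. -/
theorem integral_exp_wienerIntegral_mul_I (h : X.Integrands) :
    ∫ ω, Complex.exp (X.wienerIntegral h ω * Complex.I) ∂P = Complex.exp (-(‖h‖ ^ 2 / 2)) := by
  induction h using Completion.induction_on with
  | hp =>
    exact isClosed_eq (continuous_integral_exp_mul_I.comp X.wienerIntegral.continuous)
      (by fun_prop)
  | ih f =>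
    have h := charFun_gaussianReal (μ := 0) (v := (‖f‖ ^ 2).toNNReal) 1
    rw [← X.map_stepIntegral f, charFun_apply_real, ← wienerIntegral_coe,
      integral_map (X.aemeasurable_wienerIntegral _)
        (Continuous.aestronglyMeasurable (by fun_prop))] at h
    rw [Completion.norm_coe]
    simpa [Real.coe_toNNReal _ (sq_nonneg ‖f‖), neg_div] using h

theorem charFun_map_wienerIntegral (h : X.Integrands) (t : ℝ) :
    charFun (P.map (X.wienerIntegral h)) t = Complex.exp (-(t ^ 2 * ‖h‖ ^ 2 / 2)) := by
  have hs := X.integral_exp_wienerIntegral_mul_I (t • h)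
  rw [norm_smul, ← Complex.ofReal_pow, mul_pow, Real.norm_eq_abs, sq_abs] at hs
  rw [charFun_apply_real, integral_map (X.aemeasurable_wienerIntegral _)
    (Continuous.aestronglyMeasurable (by fun_prop))]
  rw [integral_congr_ae (g := fun ω => Complex.exp (X.wienerIntegral (t • h) ω * Complex.I)), hs]
  · simp
  · rw [map_smul]
    filter_upwards [Lp.coeFn_smul t (X.wienerIntegral h)] with ω hω
    simp [hω]

theorem map_wienerIntegral (h : X.Integrands) :
    P.map (X.wienerIntegral h) = gaussianReal 0 (‖h‖ ^ 2).toNNReal := by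
  have := Measure.isProbabilityMeasure_map (X.aemeasurable_wienerIntegral h)
  refine Measure.ext_of_charFun (funext fun t => ?_)
  rw [X.charFun_map_wienerIntegral, charFun_gaussianReal, Real.coe_toNNReal _ (sq_nonneg _)]
  congr 1
  push_cast
  ring

theorem map_wienerIntegral_of_norm_eq_one {h : X.Integrands} (hh : ‖h‖ = 1) :
    P.map (X.wienerIntegral h) = gaussianReal 0 1 := by
  rw [map_wienerIntegral, hh, one_pow, Real.toNNReal_one]

/-- The joint characteristic function at `(t₁, t₂)` is that of `I(t₁ h + t₂ g)` at `1`; by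
orthogonality its exponent splits into two summands. -/
theorem indepFun_wienerIntegral {h g : X.Integrands} (hg : ⟪h, g⟫_ℝ = 0) :
    IndepFun (X.wienerIntegral h) (X.wienerIntegral g) P := by
  have mh := X.aemeasurable_wienerIntegral h
  have mg := X.aemeasurable_wienerIntegral g
  rw [indepFun_iff_charFun_prod mh mg]
  intro t
  rw [charFun_map_wienerIntegral, charFun_map_wienerIntegral, charFun_apply, integral_map
    (by fun_prop) (Continuous.aestronglyMeasurable (by fun_prop))]
  have hs := X.integral_exp_wienerIntegral_mul_I (t.ofLp.1 • h + t.ofLp.2 • g)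
  rw [integral_congr_ae (g := fun ω =>
    Complex.exp (X.wienerIntegral (t.ofLp.1 • h + t.ofLp.2 • g) ω * Complex.I)), hs, ← Complex.exp_add]
  · have hn : ‖t.ofLp.1 • h + t.ofLp.2 • g‖ ^ 2 = t.ofLp.1 ^ 2 * ‖h‖ ^ 2 + t.ofLp.2 ^ 2 * ‖g‖ ^ 2 := by
      rw [norm_add_sq_real, real_inner_smul_left, real_inner_smul_right, hg, norm_smul, norm_smul,
        mul_pow, mul_pow, Real.norm_eq_abs, Real.norm_eq_abs, sq_abs, sq_abs]
      ring
    rw [← Complex.ofReal_pow, hn]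
    congr 1
    push_cast
    ring
  · rw [map_add, map_smul, map_smul]
    filter_upwards [Lp.coeFn_add (t.ofLp.1 • X.wienerIntegral h) (t.ofLp.2 • X.wienerIntegral g),
      Lp.coeFn_smul t.ofLp.1 (X.wienerIntegral h), Lp.coeFn_smul t.ofLp.2 (X.wienerIntegral g)]
      with ω h1 h2 h3
    rw [h1, Pi.add_apply, h2, h3, WithLp.prod_inner_apply]
    simp

theorem integrable_exp_wienerIntegral (h : X.Integrands) :
    Integrable (fun ω => Real.exp (X.wienerIntegral h ω)) P := by
  have := integrable_exp_mul_gaussianReal (μ := 0) (v := (‖h‖ ^ 2).toNNReal) 1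
  rw [← X.map_wienerIntegral h, integrable_map_measure
    (Continuous.aestronglyMeasurable (by fun_prop)) (X.aemeasurable_wienerIntegral h)] at this
  simpa [Function.comp_def] using this

theorem integral_exp_wienerIntegral (h : X.Integrands) :
    ∫ ω, Real.exp (X.wienerIntegral h ω) ∂P = Real.exp (‖h‖ ^ 2 / 2) := by
  have := mgf_gaussianReal (X.map_wienerIntegral h) 1
  simpa [mgf, Real.coe_toNNReal _ (sq_nonneg ‖h‖)] using this

theorem memLp_exp_wienerIntegral (h : X.Integrands) :
    MemLp (fun ω => Real.exp (X.wienerIntegral h ω)) 2 P := by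
  rw [memLp_two_iff_integrable_sq
    (Real.continuous_exp.comp_aestronglyMeasurable (Lp.aestronglyMeasurable _))]
  -- The square of `exp(I(h))` is `exp(I(2h))`.
  refine (X.integrable_exp_wienerIntegral ((2 : ℝ) • h)).congr ?_
  rw [map_smul]
  filter_upwards [Lp.coeFn_smul (2 : ℝ) (X.wienerIntegral h)] with ω hω
  rw [hω, Pi.smul_apply, smul_eq_mul, two_mul, Real.exp_add, sq]

omit [IsProbabilityMeasure P] in
theorem wickExp_eq (h : X.Integrands) (ω : Ω) :
    X.wickExp h ω = Real.exp (-(‖h‖ ^ 2 / 2)) * Real.exp (X.wienerIntegral h ω) := by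
  rw [wickExp, integral_wienerIntegral_sq, ← Real.exp_add]
  congr 1
  ring

theorem memLp_wickExp (h : X.Integrands) : MemLp (X.wickExp h) 2 P := by
  have : X.wickExp h =
      fun ω => Real.exp (-(‖h‖ ^ 2 / 2)) * Real.exp (X.wienerIntegral h ω) :=
    funext fun ω => X.wickExp_eq h ω
  rw [this]
  exact (X.memLp_exp_wienerIntegral h).const_mul _

/-- The Wick exponential as an element of `L²(P)`. -/
def wickLp (h : X.Integrands) : Lp ℝ 2 P := (X.memLp_wickExp h).toLp _

theorem sTransform_eq_inner (ξ : Lp ℝ 2 P) (h : X.Integrands) :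
    X.sTransform ξ h = ⟪X.wickLp h, ξ⟫_ℝ := by
  rw [L2.inner_def, sTransform]
  refine integral_congr_ae ?_
  filter_upwards [(X.memLp_wickExp h).coeFn_toLp] with ω hω
  rw [wickLp, hω]
  simp

/-- The product of the exponentials is `exp(I(h + g))`; after normalisation only the cross term of
`‖h + g‖²` survives. -/
theorem inner_wickLp (h g : X.Integrands) :
    ⟪X.wickLp h, X.wickLp g⟫_ℝ = Real.exp ⟪h, g⟫_ℝ := by
  have key : ∫ ω, Real.exp (-(‖h‖ ^ 2 / 2) - ‖g‖ ^ 2 / 2) *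
      Real.exp (X.wienerIntegral (h + g) ω) ∂P = Real.exp ⟪h, g⟫_ℝ := by
    rw [integral_const_mul, integral_exp_wienerIntegral, ← Real.exp_add, norm_add_sq_real]
    congr 1
    ring
  rw [← key, L2.inner_def]
  refine integral_congr_ae ?_
  rw [map_add]
  filter_upwards [(X.memLp_wickExp h).coeFn_toLp, (X.memLp_wickExp g).coeFn_toLp,
    Lp.coeFn_add (X.wienerIntegral h) (X.wienerIntegral g)] with ω h1 h2 h3
  rw [wickLp, wickLp, h1, h2, h3, wickExp_eq, wickExp_eq, Pi.add_apply, Real.exp_add, sub_eq_add_neg,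
    Real.exp_add]
  simp
  ring

end CenteredGaussianProc

/-! ### The space `L²_X` and totality of the Wick exponentials -/

namespace CenteredGaussianProc

variable {Ω : Type*} [MeasurableSpace Ω] {P : Measure Ω} {T : ℝ} (X : CenteredGaussianProc P T)

theorem measurable_toFun (t : Set.Icc (0 : ℝ) T) : Measurable (X.toFun t) :=
  X.measurable_uncurry.comp measurable_prodMk_left

theorem sigmaAlgebra_le : X.sigmaAlgebra ≤ ‹MeasurableSpace Ω› :=
  iSup_le fun t => (X.measurable_toFun t).comap_le

theorem mem_L2X_iff (ξ : Lp ℝ 2 P) :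
    ξ ∈ X.L2X ↔ AEStronglyMeasurable[X.sigmaAlgebra] ξ P :=
  mem_lpMeas_iff_aestronglyMeasurable

theorem isClosed_L2X : IsClosed (X.L2X : Set (Lp ℝ 2 P)) := by
  have : Fact (X.sigmaAlgebra ≤ ‹MeasurableSpace Ω›) := ⟨X.sigmaAlgebra_le⟩
  have hc : CompleteSpace (lpMeas ℝ ℝ X.sigmaAlgebra 2 P) := inferInstance
  exact (completeSpace_coe_iff_isComplete.mp hc).isClosed

theorem toLp_mem_L2X {f : Ω → ℝ} (hf : MemLp f 2 P) (h : AEStronglyMeasurable[X.sigmaAlgebra] f P) :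
    hf.toLp f ∈ X.L2X :=
  (X.mem_L2X_iff _).mpr (h.congr hf.coeFn_toLp.symm)

theorem val_mem_L2X (t : Set.Icc (0 : ℝ) T) : X.val t ∈ X.L2X := by
  refine X.toLp_mem_L2X (X.memLp t) ?_
  have : Measurable[X.sigmaAlgebra] (X.toFun t) :=
    measurable_iff_comap_le.mpr (le_iSup (fun t => MeasurableSpace.comap (X.toFun t) _) t)
  exact this.stronglyMeasurable.aestronglyMeasurable

theorem wienerIntegral_mem_L2X (h : X.Integrands) : X.wienerIntegral h ∈ X.L2X := by
  induction h using Completion.induction_on with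
  | hp => exact X.isClosed_L2X.preimage X.wienerIntegral.continuous
  | ih f =>
    rw [wienerIntegral_coe]
    exact Submodule.sum_mem _ fun t _ => Submodule.smul_mem _ _ (X.val_mem_L2X _)

theorem wienerIntegral_ind (t : Set.Icc (0 : ℝ) T) : X.wienerIntegral (X.ind t) = X.val t := by
  rw [ind, wienerIntegral_coe]
  by_cases ht : 0 < (t : ℝ)
  · have hc : X.coeffs (X.stepInd t) = Finsupp.single ⟨t, ht, t.2.2⟩ 1 :=
      (linearIndependent_indIoc T).repr_eq_single ⟨t, ht, t.2.2⟩ _ rfl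
    rw [stepIntegral, LinearMap.comp_apply, hc, Finsupp.linearCombination_single, one_smul]
    rfl
  · have h0 : X.stepInd t = 0 := by
      refine Subtype.ext ?_
      change indIoc t = 0
      rw [indIoc, Set.Ioc_eq_empty ht, Set.indicator_empty]
      rfl
    -- At `t = 0` the indicator is the zero function, so the identity requires `X_0 = 0` almost
    -- surely.
    have hv : X.val t = 0 := by
      rw [Lp.eq_zero_iff_ae_eq_zero]
      exact (X.memLp t).coeFn_toLp.trans (X.zero_ae t (le_antisymm (not_lt.mp ht) t.2.1))
    rw [h0, map_zero, hv]

theorem wienerIntegral_sum_ind (J : Finset (Set.Icc (0 : ℝ) T)) (a : Set.Icc (0 : ℝ) T → ℝ) :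
    X.wienerIntegral (∑ t ∈ J, a t • X.ind t) =ᵐ[P] fun ω => ∑ t ∈ J, a t * X.toFun t ω := by
  simp only [map_sum, map_smul, wienerIntegral_ind]
  refine (Lp.coeFn_finsetSum _ _).trans ?_
  have : ∀ t ∈ J, (a t • X.val t : Lp ℝ 2 P) =ᵐ[P] fun ω => a t * X.toFun t ω := fun t _ => by
    filter_upwards [Lp.coeFn_smul (a t) (X.val t), (X.memLp t).coeFn_toLp] with ω h1 h2
    rw [h1, Pi.smul_apply, val, h2, smul_eq_mul]
  filter_upwards [(Filter.eventually_all_finset _).mpr this] with ω hω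
  rw [Finset.sum_apply]
  exact Finset.sum_congr rfl hω

/-- The path map of `X`. -/
def path (ω : Ω) (t : Set.Icc (0 : ℝ) T) : ℝ := X.toFun t ω

theorem measurable_path : Measurable X.path := measurable_pi_lambda _ fun t => X.measurable_toFun t

/-- Events of `ℱ_T^X` become preimages of product-measurable sets, so they can be tested by
comparing laws on path space. -/
theorem sigmaAlgebra_eq_comap_path :
    X.sigmaAlgebra = MeasurableSpace.comap X.path MeasurableSpace.pi := by
  rw [MeasurableSpace.pi, MeasurableSpace.comap_iSup]
  simp only [MeasurableSpace.comap_comp]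
  rfl

variable [IsProbabilityMeasure P]

theorem wickLp_mem_L2X (h : X.Integrands) : X.wickLp h ∈ X.L2X := by
  refine X.toLp_mem_L2X (X.memLp_wickExp h) ?_
  have : X.wickExp h =
      fun ω => Real.exp (-(‖h‖ ^ 2 / 2)) * Real.exp (X.wienerIntegral h ω) :=
    funext fun ω => X.wickExp_eq h ω
  rw [this]
  exact Continuous.comp_aestronglyMeasurable
    (g := fun x : ℝ => Real.exp (-(‖h‖ ^ 2 / 2)) * Real.exp x) (by fun_prop)
    ((X.mem_L2X_iff _).mp (X.wienerIntegral_mem_L2X h))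

theorem integral_mul_exp_eq_zero {ξ : Lp ℝ 2 P} (h : ∀ h, ⟪X.wickLp h, ξ⟫_ℝ = 0)
    (g : X.Integrands) : ∫ ω, Real.exp (X.wienerIntegral g ω) * ξ ω ∂P = 0 := by
  have := h g
  rw [← sTransform_eq_inner, sTransform] at this
  simp only [wickExp_eq] at this
  rw [integral_congr_ae (g := fun ω => Real.exp (-(‖g‖ ^ 2 / 2)) *
    (Real.exp (X.wienerIntegral g ω) * ξ ω)) (ae_of_all _ fun ω => by ring),
    integral_const_mul] at this
  exact (mul_eq_zero.mp this).resolve_left (Real.exp_pos _).ne'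

/-- The measure with density the positive part of `ξ`. -/
def posPartMeasure (P : Measure Ω) (ξ : Ω → ℝ) : Measure Ω :=
  P.withDensity fun ω => ENNReal.ofReal (ξ ω)

omit [IsProbabilityMeasure P] in
theorem isFiniteMeasure_posPartMeasure {ξ : Ω → ℝ} (hξ : Integrable ξ P) :
    IsFiniteMeasure (posPartMeasure P ξ) :=
  isFiniteMeasure_withDensity_ofReal hξ.2

omit [IsProbabilityMeasure P] in
theorem integral_posPartMeasure {ξ : Ω → ℝ} (hξ : Integrable ξ P) (f : Ω → ℝ) :
    ∫ ω, f ω ∂posPartMeasure P ξ = ∫ ω, f ω * max (ξ ω) 0 ∂P := by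
  rw [posPartMeasure, integral_withDensity_eq_integral_toReal_smul₀
    hξ.aestronglyMeasurable.aemeasurable.ennreal_ofReal (ae_of_all _ fun _ => ENNReal.ofReal_lt_top)]
  refine integral_congr_ae (ae_of_all _ fun ω => ?_)
  simp only [ENNReal.toReal_ofReal', smul_eq_mul]
  ring

omit [IsProbabilityMeasure P] in
theorem integrable_posPartMeasure {ξ : Ω → ℝ} (hξ : MemLp ξ 2 P) (hi : Integrable ξ P)
    {f : Ω → ℝ} (hf : MemLp f 2 P) : Integrable f (posPartMeasure P ξ) := by
  rw [posPartMeasure, integrable_withDensity_iff_integrable_smul₀'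
    hi.aestronglyMeasurable.aemeasurable.ennreal_ofReal (ae_of_all _ fun _ => ENNReal.ofReal_lt_top)]
  simp only [ENNReal.toReal_ofReal', smul_eq_mul]
  exact hξ.pos_part.integrable_mul hf

omit [IsProbabilityMeasure P] in
theorem integral_posPartMeasure_sub {ξ : Ω → ℝ} (hξ : MemLp ξ 2 P) (hi : Integrable ξ P)
    {f : Ω → ℝ} (hf : MemLp f 2 P) :
    ∫ ω, f ω ∂posPartMeasure P ξ - ∫ ω, f ω ∂posPartMeasure P (-ξ) = ∫ ω, f ω * ξ ω ∂P := by
  rw [integral_posPartMeasure hi, integral_posPartMeasure hi.neg, ← integral_sub]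
  · refine integral_congr_ae (ae_of_all _ fun ω => ?_)
    rcases le_total (ξ ω) 0 with h | h
    · simp [h]
    · simp [h]
  · exact hf.integrable_mul hξ.pos_part
  · exact hf.integrable_mul hξ.neg.pos_part

/-- A linear functional `Y` of finitely many coordinates is almost surely a Wiener integral, so
`exp(sY)` is a multiple of a Wick exponential for every real `s`. Orthogonality then says that `Y`
has the same moment generating function under the densities `ξ⁺` and `ξ⁻`, and analytic continuation
to the imaginary axis gives equal characteristic functions. -/
theorem charFunDual_map_path_eq {ξ : Lp ℝ 2 P} (h : ∀ h, ⟪X.wickLp h, ξ⟫_ℝ = 0)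
    (J : Finset (Set.Icc (0 : ℝ) T)) :
    charFunDual (((posPartMeasure P ξ).map X.path).map J.restrict) =
      charFunDual (((posPartMeasure P (-ξ)).map X.path).map J.restrict) := by
  classical
  have hi : Integrable ξ P := (Lp.memLp ξ).integrable (by norm_num)
  have f1 := isFiniteMeasure_posPartMeasure hi
  have f2 := isFiniteMeasure_posPartMeasure hi.neg
  ext L
  -- The coefficients of `L` in the coordinate basis of `ℝ^J`, extended by `0` off `J`.
  set a : Set.Icc (0 : ℝ) T → ℝ := fun t => if ht : t ∈ J then L (Pi.single ⟨t, ht⟩ 1) else 0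
  set Y : Ω → ℝ := fun ω => ∑ t ∈ J, a t * X.toFun t ω with hY
  have hLY : ∀ ω, L (J.restrict (X.path ω)) = Y ω := by
    intro ω
    have e : J.restrict (X.path ω) =
        ∑ t : J, X.toFun t ω • (Pi.single t (1 : ℝ) : J → ℝ) := by
      ext s
      simp [Finset.sum_apply, Pi.single_apply, path]
    rw [e, map_sum, hY]
    simp only [map_smul, smul_eq_mul]
    rw [← Finset.sum_coe_sort J]
    refine Finset.sum_congr rfl fun t _ => ?_
    simp only [a, t.2, dite_true]
    ring
  have hYm : Measurable Y := by
    refine Finset.measurable_sum _ fun t _ => ?_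
    exact (X.measurable_toFun t).const_mul _
  have hexp : ∀ s : ℝ, ∃ g : X.Integrands,
      (fun ω => Real.exp (X.wienerIntegral g ω)) =ᵐ[P] fun ω => Real.exp (s * Y ω) := by
    intro s
    refine ⟨∑ t ∈ J, (s * a t) • X.ind t, ?_⟩
    filter_upwards [X.wienerIntegral_sum_ind J fun t => s * a t] with ω hω
    rw [hω, hY, Finset.mul_sum]
    simp only [mul_assoc]
  have hexpL2 : ∀ s : ℝ, MemLp (fun ω => Real.exp (s * Y ω)) 2 P := fun s => by
    obtain ⟨g, hg⟩ := hexp s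
    exact (memLp_congr_ae hg).mp (X.memLp_exp_wienerIntegral g)
  have hmgf : mgf Y (posPartMeasure P ξ) = mgf Y (posPartMeasure P (-ξ)) := by
    ext s
    rw [mgf, mgf, ← sub_eq_zero, integral_posPartMeasure_sub (Lp.memLp ξ) hi (hexpL2 s)]
    obtain ⟨g, hg⟩ := hexp s
    rw [← X.integral_mul_exp_eq_zero h g]
    refine integral_congr_ae ?_
    filter_upwards [hg] with ω hω
    rw [hω]
  have hzero : posPartMeasure P ξ = 0 ↔ posPartMeasure P (-ξ) = 0 := by
    have := congrFun hmgf 0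
    simp only [mgf_zero'] at this
    rw [← Measure.measure_univ_eq_zero, ← Measure.measure_univ_eq_zero, ← measureReal_eq_zero_iff,
      ← measureReal_eq_zero_iff, this]
  have hset : integrableExpSet Y (posPartMeasure P ξ) = Set.univ :=
    Set.eq_univ_of_forall fun s => integrable_posPartMeasure (Lp.memLp ξ) hi (hexpL2 s)
  -- Exponential moments exist for all real `s`, so the strip of analyticity is the whole plane and
  -- contains `i`.
  have hc := eqOn_complexMGF_of_mgf' hmgf hzero (x := Complex.I) (by simp [hset])
  have hrw : ∀ μ : Measure Ω, charFunDual ((μ.map X.path).map J.restrict) L =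
      complexMGF Y μ Complex.I := by
    intro μ
    rw [charFunDual_apply, integral_map (by fun_prop)
      (Continuous.aestronglyMeasurable (by fun_prop)), integral_map X.measurable_path.aemeasurable
      (Measurable.aestronglyMeasurable (by fun_prop)), complexMGF]
    refine integral_congr_ae (ae_of_all _ fun ω => ?_)
    simp only [hLY, mul_comm]
  rw [hrw, hrw, hc]

/-- The Wick exponentials are total in `L²_X`. -/
theorem eq_zero_of_inner_wickLp_eq_zero {ξ : Lp ℝ 2 P} (hξ : ξ ∈ X.L2X)
    (h : ∀ h, ⟪X.wickLp h, ξ⟫_ℝ = 0) : ξ = 0 := by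
  have hi : Integrable ξ P := (Lp.memLp ξ).integrable (by norm_num)
  have f1 := isFiniteMeasure_posPartMeasure hi
  have f2 := isFiniteMeasure_posPartMeasure hi.neg
  -- A finite measure on path space is determined by its finite-dimensional marginals.
  have hmap : (posPartMeasure P ξ).map X.path = (posPartMeasure P (-ξ)).map X.path := by
    refine IsProjectiveLimit.unique
      (P := fun J => ((posPartMeasure P ξ).map X.path).map J.restrict) (fun J => rfl) fun J => ?_
    exact Measure.ext_of_charFunDual (X.charFunDual_map_path_eq h J).symm
  -- Equal laws of the path give `ξ⁺` and `ξ⁻` the same integral over every event of `ℱ_T^X`; as `ξ`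
  -- is measurable for this `σ`-algebra, it vanishes.
  have hset : ∀ s, MeasurableSet[X.sigmaAlgebra] s → ∫ ω in s, ξ ω ∂P = 0 := by
    intro s hs
    have hs' := X.sigmaAlgebra_le s hs
    rw [sigmaAlgebra_eq_comap_path] at hs
    obtain ⟨B, hB, rfl⟩ := hs
    have e := congrArg (fun μ => μ.real B) hmap
    simp only [measureReal_def, Measure.map_apply X.measurable_path hB] at e
    have hL2 : MemLp ((X.path ⁻¹' B).indicator fun _ => (1 : ℝ)) 2 P :=
      memLp_indicator_const 2 hs' 1 (Or.inr (measure_ne_top _ _))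
    have := integral_posPartMeasure_sub (Lp.memLp ξ) hi hL2
    rw [integral_indicator_const _ hs', integral_indicator_const _ hs', measureReal_def,
      measureReal_def, e, sub_self] at this
    refine Eq.trans ?_ this.symm
    rw [← integral_indicator hs']
    refine integral_congr_ae (ae_of_all _ fun ω => ?_)
    by_cases hω : ω ∈ X.path ⁻¹' B <;> simp [hω]
  have := lpMeas.ae_eq_zero_of_forall_setIntegral_eq_zero X.sigmaAlgebra_le
    (⟨ξ, hξ⟩ : lpMeas ℝ ℝ X.sigmaAlgebra 2 P) (by norm_num) (by norm_num)
    (fun s _ _ => hi.integrableOn) (fun s hs _ => hset s hs)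
  exact (Lp.eq_zero_iff_ae_eq_zero).mpr this

theorem eq_of_inner_wickLp_eq {ξ η : Lp ℝ 2 P} (hξ : ξ ∈ X.L2X) (hη : η ∈ X.L2X)
    (h : ∀ h, ⟪X.wickLp h, ξ⟫_ℝ = ⟪X.wickLp h, η⟫_ℝ) : ξ = η := by
  rw [← sub_eq_zero]
  refine X.eq_zero_of_inner_wickLp_eq_zero (Submodule.sub_mem _ hξ hη) fun g => ?_
  rw [inner_sub_right, h, sub_self]

/-! ### Hermite variables and their pairings -/

/-- The variable `H_n(I(h))` as an element of `L²(P)`. -/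
def hermiteLp (n : ℕ) (h : X.Integrands) : Lp ℝ 2 P :=
  (memLp_eval_of_map_eq_gaussianReal (X.aemeasurable_wienerIntegral h) (X.map_wienerIntegral h)
    (hermiteReal n)).toLp _

theorem coeFn_hermiteLp (n : ℕ) (h : X.Integrands) :
    X.hermiteLp n h =ᵐ[P] fun ω => (hermiteReal n).eval (X.wienerIntegral h ω) :=
  MemLp.coeFn_toLp _

theorem hermiteLp_mem_L2X (n : ℕ) (h : X.Integrands) : X.hermiteLp n h ∈ X.L2X :=
  X.toLp_mem_L2X _ ((hermiteReal n).continuous.comp_aestronglyMeasurable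
    ((X.mem_L2X_iff _).mp (X.wienerIntegral_mem_L2X h)))

omit [IsProbabilityMeasure P] in
theorem wienerIntegral_ae_add (h g : X.Integrands) (ρ : ℝ) :
    X.wienerIntegral g =ᵐ[P] fun ω => ρ * X.wienerIntegral h ω + X.wienerIntegral (g - ρ • h) ω := by
  have e : X.wienerIntegral g = ρ • X.wienerIntegral h + X.wienerIntegral (g - ρ • h) := by
    rw [← map_smul, ← map_add, add_sub_cancel]
  filter_upwards [Lp.coeFn_add (ρ • X.wienerIntegral h) (X.wienerIntegral (g - ρ • h)),
    Lp.coeFn_smul ρ (X.wienerIntegral h)] with ω h1 h2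
  rw [e, h1, Pi.add_apply, h2, Pi.smul_apply, smul_eq_mul]

omit [IsProbabilityMeasure P] in
theorem inner_sub_smul_self {h : X.Integrands} (hh : ‖h‖ = 1) (g : X.Integrands) :
    ⟪h, g - ⟪h, g⟫_ℝ • h⟫_ℝ = 0 := by
  rw [inner_sub_right, real_inner_smul_right, real_inner_self_eq_norm_sq, hh]
  ring

/-- Split `g = ⟪h, g⟫ h + k` with `k ⊥ h`: then `I(k)` is independent of `I(h)`, and the formula for
correlated variables applies. -/
theorem inner_hermiteLp_hermiteLp {h g : X.Integrands} (hh : ‖h‖ = 1) (hg : ‖g‖ = 1) (m n : ℕ) :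
    ⟪X.hermiteLp m h, X.hermiteLp n g⟫_ℝ = if m = n then (n ! : ℝ) * ⟪h, g⟫_ℝ ^ n else 0 := by
  have hae := X.wienerIntegral_ae_add h g ⟪h, g⟫_ℝ
  rw [← integral_hermiteReal_mul_hermiteReal (X.aemeasurable_wienerIntegral h)
    (X.aemeasurable_wienerIntegral (g - ⟪h, g⟫_ℝ • h))
    (X.indepFun_wienerIntegral (X.inner_sub_smul_self hh g)) ⟪h, g⟫_ℝ
    (X.map_wienerIntegral_of_norm_eq_one hh)
    (by rw [← Measure.map_congr hae, X.map_wienerIntegral_of_norm_eq_one hg]) m n, L2.inner_def]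
  refine integral_congr_ae ?_
  filter_upwards [X.coeFn_hermiteLp m h, X.coeFn_hermiteLp n g, hae] with ω h1 h2 h3
  rw [h1, h2, ← h3]
  simp [mul_comm]

/-- Same splitting of `g`: the independent factor `exp(I(k))` integrates to `exp(‖k‖²/2)`, and `‖g‖²
= ρ² + ‖k‖²` cancels all exponentials. This is the `S`-transform of a Hermite variable. -/
theorem inner_wickLp_hermiteLp {h : X.Integrands} (hh : ‖h‖ = 1) (g : X.Integrands) (n : ℕ) :
    ⟪X.wickLp g, X.hermiteLp n h⟫_ℝ = ⟪h, g⟫_ℝ ^ n := by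
  set ρ := ⟪h, g⟫_ℝ with hρ
  set k := g - ρ • h with hk
  have hae := X.wienerIntegral_ae_add h g ρ
  have hind := X.indepFun_wienerIntegral (X.inner_sub_smul_self hh g)
  have hU := X.aemeasurable_wienerIntegral h
  have hV := X.aemeasurable_wienerIntegral k
  have hnorm : ‖g‖ ^ 2 = ρ ^ 2 + ‖k‖ ^ 2 := by
    have : g = ρ • h + k := by rw [hk, add_sub_cancel]
    conv_lhs => rw [this]
    rw [norm_add_sq_real, real_inner_smul_left, X.inner_sub_smul_self hh g, norm_smul, hh,
      mul_one, Real.norm_eq_abs, sq_abs]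
    ring
  have h1 : ∫ ω, (hermiteReal n).eval (X.wienerIntegral h ω) *
      Real.exp (ρ * X.wienerIntegral h ω) ∂P = ρ ^ n * Real.exp (ρ ^ 2 / 2) := by
    rw [← integral_hermiteReal_mul_exp, ← X.map_wienerIntegral_of_norm_eq_one hh,
      integral_map hU (Continuous.aestronglyMeasurable (by fun_prop))]
  have hmeas : Measurable fun x => (hermiteReal n).eval x * Real.exp (ρ * x) :=
    Continuous.measurable (by fun_prop)
  have hind' := hind.comp hmeas Real.measurable_exp
  have h2 := hind'.integral_fun_mul_eq_mul_integral
    (Continuous.comp_aestronglyMeasurable (g := fun x => (hermiteReal n).eval x * Real.exp (ρ * x))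
      (by fun_prop) hU.aestronglyMeasurable)
    (Real.continuous_exp.comp_aestronglyMeasurable hV.aestronglyMeasurable)
  simp only [Function.comp_apply] at h2
  rw [h1, X.integral_exp_wienerIntegral] at h2
  calc ⟪X.wickLp g, X.hermiteLp n h⟫_ℝ
      = ∫ ω, Real.exp (-(‖g‖ ^ 2 / 2)) * (((hermiteReal n).eval (X.wienerIntegral h ω) *
          Real.exp (ρ * X.wienerIntegral h ω)) * Real.exp (X.wienerIntegral k ω)) ∂P := by
        rw [L2.inner_def]
        refine integral_congr_ae ?_
        filter_upwards [X.coeFn_hermiteLp n h, (X.memLp_wickExp g).coeFn_toLp, hae] with ω e1 e2 e3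
        rw [e1, wickLp, e2, wickExp_eq, e3, Real.exp_add]
        simp only [RCLike.inner_apply, conj_trivial]
        ring
    _ = ρ ^ n := by
        rw [integral_const_mul, h2, hnorm]
        have : Real.exp (-((ρ ^ 2 + ‖k‖ ^ 2) / 2)) * (Real.exp (ρ ^ 2 / 2) *
            Real.exp (‖k‖ ^ 2 / 2)) = 1 := by
          rw [← Real.exp_add, ← Real.exp_add, ← Real.exp_zero]
          congr 1
          ring
        linear_combination ρ ^ n * this

end CenteredGaussianProc

/-! ### Multiple Wiener integrals through their closed graph -/

theorem TensorPow.pow_zero_succ {H : Type} [NormedAddCommGroup H] [InnerProductSpace ℝ H] (n : ℕ) :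
    TensorPow.pow (0 : H) (n + 1) = 0 := by
  have := TensorPow.pow_smul (0 : ℝ) (0 : H) (n + 1)
  simpa using this

namespace CenteredGaussianProc

variable {Ω : Type*} [MeasurableSpace Ω] {P : Measure Ω} {T : ℝ} (X : CenteredGaussianProc P T)

/-- Induction principle for the graph: a closed linear condition on pairs need only be checked on
the generators. -/
theorem apply_mem_of_mem_chaosGraph {q : ℕ} {G : Type*} [NormedAddCommGroup G] [NormedSpace ℝ G]
    (L : TensorPow X.Integrands q × Lp ℝ 2 P →L[ℝ] G) {K : Submodule ℝ G}
    (hK : IsClosed (K : Set G))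
    (hL : ∀ (h : X.Integrands) (η : Lp ℝ 2 P), ‖h‖ = 1 →
      (η =ᵐ[P] fun ω => Polynomial.aeval (X.wienerIntegral h ω) (Polynomial.hermite q)) →
      L (TensorPow.pow h q, η) ∈ K)
    {p : TensorPow X.Integrands q × Lp ℝ 2 P} (hp : p ∈ X.chaosGraph q) : L p ∈ K := by
  have hle : X.chaosGraph q ≤ K.comap L.toLinearMap := by
    refine Submodule.topologicalClosure_minimal _ ?_ (hK.preimage L.continuous)
    rw [Submodule.span_le]
    rintro ⟨f, η⟩ ⟨h, hh, rfl, hη⟩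
    exact hL h η hh hη
  exact hle hp

variable [IsProbabilityMeasure P]

theorem eq_hermiteLp {q : ℕ} {h : X.Integrands} {η : Lp ℝ 2 P}
    (hη : η =ᵐ[P] fun ω => Polynomial.aeval (X.wienerIntegral h ω) (Polynomial.hermite q)) :
    η = X.hermiteLp q h := by
  refine Lp.ext (hη.trans ?_)
  filter_upwards [X.coeFn_hermiteLp q h] with ω hω
  rw [hω, aeval_hermite]

theorem apply_mem_of_mem_chaosGraph' {q : ℕ} {G : Type*} [NormedAddCommGroup G] [NormedSpace ℝ G]
    (L : TensorPow X.Integrands q × Lp ℝ 2 P →L[ℝ] G) {K : Submodule ℝ G}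
    (hK : IsClosed (K : Set G))
    (hL : ∀ h : X.Integrands, ‖h‖ = 1 → L (TensorPow.pow h q, X.hermiteLp q h) ∈ K)
    {p : TensorPow X.Integrands q × Lp ℝ 2 P} (hp : p ∈ X.chaosGraph q) : L p ∈ K :=
  X.apply_mem_of_mem_chaosGraph L hK (fun h η hh hη => by
    rw [X.eq_hermiteLp hη]; exact hL h hh) hp

theorem eq_zero_of_mem_chaosGraph {q : ℕ} (L : TensorPow X.Integrands q × Lp ℝ 2 P →L[ℝ] ℝ)
    (hL : ∀ h : X.Integrands, ‖h‖ = 1 → L (TensorPow.pow h q, X.hermiteLp q h) = 0)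
    {p : TensorPow X.Integrands q × Lp ℝ 2 P} (hp : p ∈ X.chaosGraph q) : L p = 0 :=
  (Submodule.mem_bot ℝ).mp
    (X.apply_mem_of_mem_chaosGraph' L (K := ⊥) isClosed_singleton
      (fun h hh => (Submodule.mem_bot ℝ).mpr (hL h hh)) hp)

theorem pow_hermiteLp_mem_chaosGraph (q : ℕ) {h : X.Integrands} (hh : ‖h‖ = 1) :
    (TensorPow.pow h q, X.hermiteLp q h) ∈ X.chaosGraph q := by
  refine Submodule.le_topologicalClosure _ (Submodule.subset_span ⟨h, hh, rfl, ?_⟩)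
  filter_upwards [X.coeFn_hermiteLp q h] with ω hω
  rw [hω, aeval_hermite]

theorem snd_mem_L2X_of_mem_chaosGraph {q : ℕ} {p : TensorPow X.Integrands q × Lp ℝ 2 P}
    (hp : p ∈ X.chaosGraph q) : p.2 ∈ X.L2X :=
  X.apply_mem_of_mem_chaosGraph' (ContinuousLinearMap.snd ℝ _ _) X.isClosed_L2X
    (fun h _ => X.hermiteLp_mem_L2X q h) hp

theorem inner_wickLp_of_mem_chaosGraph {q : ℕ} {p : TensorPow X.Integrands q × Lp ℝ 2 P}
    (hp : p ∈ X.chaosGraph q) (g : X.Integrands) :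
    ⟪X.wickLp g, p.2⟫_ℝ = ⟪TensorPow.pow g q, p.1⟫_ℝ := by
  have := X.eq_zero_of_mem_chaosGraph
    ((innerSL ℝ (X.wickLp g)).comp (ContinuousLinearMap.snd ℝ _ _) -
      (innerSL ℝ (TensorPow.pow g q)).comp (ContinuousLinearMap.fst ℝ _ _))
    (fun h hh => by
      simp [X.inner_wickLp_hermiteLp hh, TensorPow.inner_pow, real_inner_comm]) hp
  simpa [sub_eq_zero] using this

theorem inner_of_mem_chaosGraph {q : ℕ} {p p' : TensorPow X.Integrands q × Lp ℝ 2 P}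
    (hp : p ∈ X.chaosGraph q) (hp' : p' ∈ X.chaosGraph q) :
    ⟪p.2, p'.2⟫_ℝ = (q ! : ℝ) * ⟪p.1, p'.1⟫_ℝ := by
  -- Extends the second argument from generators to the whole graph. It is used twice, the roles
  -- being exchanged by symmetry.
  have key : ∀ p : TensorPow X.Integrands q × Lp ℝ 2 P,
      (∀ h : X.Integrands, ‖h‖ = 1 →
        ⟪p.2, X.hermiteLp q h⟫_ℝ = (q ! : ℝ) * ⟪p.1, TensorPow.pow h q⟫_ℝ) →
      ∀ p' ∈ X.chaosGraph q, ⟪p.2, p'.2⟫_ℝ = (q ! : ℝ) * ⟪p.1, p'.1⟫_ℝ := by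
    intro p h p' hp'
    have := X.eq_zero_of_mem_chaosGraph
      ((innerSL ℝ p.2).comp (ContinuousLinearMap.snd ℝ _ _) -
        (q ! : ℝ) • (innerSL ℝ p.1).comp (ContinuousLinearMap.fst ℝ _ _))
      (fun g hg => by simp [h g hg]) hp'
    simpa [sub_eq_zero] using this
  refine key p (fun h hh => ?_) p' hp'
  rw [real_inner_comm, real_inner_comm (TensorPow.pow h q)]
  refine key (TensorPow.pow h q, X.hermiteLp q h) (fun g hg => ?_) p hp
  rw [X.inner_hermiteLp_hermiteLp hh hg, if_pos rfl, TensorPow.inner_pow]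

theorem inner_eq_zero_of_mem_chaosGraph {q k : ℕ} (hqk : q ≠ k)
    {p : TensorPow X.Integrands q × Lp ℝ 2 P} {p' : TensorPow X.Integrands k × Lp ℝ 2 P}
    (hp : p ∈ X.chaosGraph q) (hp' : p' ∈ X.chaosGraph k) : ⟪p.2, p'.2⟫_ℝ = 0 := by
  refine X.eq_zero_of_mem_chaosGraph ((innerSL ℝ p.2).comp (ContinuousLinearMap.snd ℝ _ _))
    (fun h hh => ?_) hp'
  simp only [ContinuousLinearMap.comp_apply, ContinuousLinearMap.coe_snd', innerSL_apply_apply]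
  rw [real_inner_comm]
  refine X.eq_zero_of_mem_chaosGraph
    ((innerSL ℝ (X.hermiteLp k h)).comp (ContinuousLinearMap.snd ℝ _ _)) (fun g hg => ?_) hp
  simp [X.inner_hermiteLp_hermiteLp hh hg, hqk.symm]

/-- On the graph `‖η‖ = √((q+1)!) ‖f‖`, so projection to the tensor is bounded below and has closed
range; the range contains all powers, hence all symmetric tensors. Positive order matters: in order
`0` the power of the zero vector is `1`, and a trivial `ℌ` has no unit vectors to generate it. -/
theorem exists_mem_chaosGraph {q : ℕ} {f : TensorPow X.Integrands (q + 1)}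
    (hf : f ∈ TensorPow.symmetric X.Integrands (q + 1)) : ∃ η, (f, η) ∈ X.chaosGraph (q + 1) := by
  have hcl : IsClosed (X.chaosGraph (q + 1) : Set (TensorPow X.Integrands (q + 1) × Lp ℝ 2 P)) :=
    Submodule.isClosed_topologicalClosure _
  have : CompleteSpace (X.chaosGraph (q + 1)) := hcl.completeSpace_coe
  let π : X.chaosGraph (q + 1) →L[ℝ] TensorPow X.Integrands (q + 1) :=
    (ContinuousLinearMap.fst ℝ _ _).comp (X.chaosGraph (q + 1)).subtypeL
  have hanti : AntilipschitzWith (Real.toNNReal (1 + √((q + 1)! : ℝ))) π := by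
    refine π.antilipschitz_of_bound fun p => ?_
    have h2 : ‖p.1.2‖ = √((q + 1)! : ℝ) * ‖p.1.1‖ := by
      rw [← sq_eq_sq₀ (norm_nonneg _) (by positivity), mul_pow, Real.sq_sqrt (by positivity),
        ← real_inner_self_eq_norm_sq, ← real_inner_self_eq_norm_sq, X.inner_of_mem_chaosGraph p.2 p.2]
    rw [Real.coe_toNNReal _ (by positivity)]
    have h0 : 0 ≤ √((q + 1)! : ℝ) := Real.sqrt_nonneg _
    have h1 : 0 ≤ ‖p.1.1‖ := norm_nonneg _
    change max ‖p.1.1‖ ‖p.1.2‖ ≤ (1 + √((q + 1)! : ℝ)) * ‖p.1.1‖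
    rw [h2]
    refine max_le ?_ ?_ <;> nlinarith
  have hrange : IsClosed (LinearMap.range π.toLinearMap : Set (TensorPow X.Integrands (q + 1))) :=
    hanti.isClosed_range π.uniformContinuous
  have hmem := TensorPow.apply_mem_of_mem_symmetric (ContinuousLinearMap.id ℝ _) hrange
    (fun h => ?_) hf
  · obtain ⟨p, hp⟩ := hmem
    refine ⟨p.1.2, ?_⟩
    have e : (f, p.1.2) = p.1 := Prod.ext hp.symm rfl
    rw [e]
    exact p.2
  -- Generators come from unit vectors; other nonzero vectors are reached by homogeneity, and the
  -- zero vector has zero power.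
  · by_cases h0 : h = 0
    · rw [h0, TensorPow.pow_zero_succ]
      exact Submodule.zero_mem _
    · have hn : ‖h‖ ≠ 0 := norm_ne_zero_iff.mpr h0
      have e : h = ‖h‖ • (‖h‖⁻¹ • h) := by rw [smul_smul, mul_inv_cancel₀ hn, one_smul]
      rw [e, TensorPow.pow_smul]
      refine Submodule.smul_mem _ _ ⟨⟨_, X.pow_hermiteLp_mem_chaosGraph (q + 1) ?_⟩, rfl⟩
      rw [norm_smul, norm_inv, norm_norm, inv_mul_cancel₀ hn]

theorem mem_chaosGraph_multipleIntegral {q : ℕ} {f : TensorPow X.Integrands (q + 1)}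
    (hf : f ∈ TensorPow.symmetric X.Integrands (q + 1)) :
    (f, X.multipleIntegral (q + 1) f) ∈ X.chaosGraph (q + 1) := by
  have h := X.exists_mem_chaosGraph hf
  rw [multipleIntegral, dif_pos h]
  exact h.choose_spec

theorem wickLp_zero : X.wickLp 0 = Lp.const 2 P (1 : ℝ) := by
  refine Lp.ext ?_
  filter_upwards [(X.memLp_wickExp 0).coeFn_toLp, Lp.coeFn_const (p := 2) (μ := P) (c := (1 : ℝ)),
    Lp.coeFn_zero ℝ 2 P] with ω h1 h2 h3
  rw [wickLp, h1, h2, wickExp_eq, map_zero, h3]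
  simp

/-- Writing constants as multiples of the Wick exponential of `0` lets order `0` follow from the
pairings already known for Wick exponentials. -/
theorem multipleIntegral_zero (a : TensorPow X.Integrands 0) :
    X.multipleIntegral 0 a = TensorPow.toReal a • X.wickLp 0 := by
  rw [wickLp_zero]
  refine Lp.ext ?_
  filter_upwards [Lp.coeFn_smul (TensorPow.toReal a) (Lp.const 2 P (1 : ℝ)),
    Lp.coeFn_const (p := 2) (μ := P) (c := (1 : ℝ)),
    Lp.coeFn_const (p := 2) (μ := P) (c := TensorPow.toReal a)] with ω h1 h2 h3
  rw [multipleIntegral, h1, h3, Pi.smul_apply, h2]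
  simp

theorem multipleIntegral_mem_L2X {q : ℕ} {f : TensorPow X.Integrands q}
    (hf : f ∈ TensorPow.symmetric X.Integrands q) : X.multipleIntegral q f ∈ X.L2X := by
  cases q with
  | zero =>
    rw [multipleIntegral_zero]
    exact Submodule.smul_mem _ _ (X.wickLp_mem_L2X 0)
  | succ q => exact X.snd_mem_L2X_of_mem_chaosGraph (X.mem_chaosGraph_multipleIntegral hf)

theorem inner_wickLp_multipleIntegral {q : ℕ} {f : TensorPow X.Integrands q}
    (hf : f ∈ TensorPow.symmetric X.Integrands q) (g : X.Integrands) :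
    ⟪X.wickLp g, X.multipleIntegral q f⟫_ℝ = ⟪TensorPow.pow g q, f⟫_ℝ := by
  cases q with
  | zero =>
    rw [multipleIntegral_zero, real_inner_smul_right, inner_wickLp, TensorPow.inner_zero_eq,
      inner_zero_right, Real.exp_zero]
    exact mul_comm _ _
  | succ q => exact X.inner_wickLp_of_mem_chaosGraph (X.mem_chaosGraph_multipleIntegral hf) g

theorem norm_multipleIntegral {q : ℕ} {f : TensorPow X.Integrands q}
    (hf : f ∈ TensorPow.symmetric X.Integrands q) :
    ‖X.multipleIntegral q f‖ = √(q ! : ℝ) * ‖f‖ := by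
  rw [← sq_eq_sq₀ (norm_nonneg _) (by positivity), mul_pow, Real.sq_sqrt (by positivity),
    ← real_inner_self_eq_norm_sq, ← real_inner_self_eq_norm_sq]
  cases q with
  | zero =>
    rw [multipleIntegral_zero, real_inner_smul_right, real_inner_smul_left, inner_wickLp,
      TensorPow.inner_zero_eq]
    simp
  | succ q =>
    exact X.inner_of_mem_chaosGraph (X.mem_chaosGraph_multipleIntegral hf)
      (X.mem_chaosGraph_multipleIntegral hf)

theorem inner_multipleIntegral_eq_zero {q k : ℕ} (hqk : q ≠ k) {f : TensorPow X.Integrands q}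
    {g : TensorPow X.Integrands k} (hf : f ∈ TensorPow.symmetric X.Integrands q)
    (hg : g ∈ TensorPow.symmetric X.Integrands k) :
    ⟪X.multipleIntegral q f, X.multipleIntegral k g⟫_ℝ = 0 := by
  cases q with
  | zero =>
    cases k with
    | zero => exact absurd rfl hqk
    | succ k =>
      rw [multipleIntegral_zero, real_inner_smul_left, X.inner_wickLp_multipleIntegral hg,
        TensorPow.pow_zero_succ, inner_zero_left, mul_zero]
  | succ q =>
    cases k with
    | zero =>
      rw [multipleIntegral_zero, real_inner_smul_right, real_inner_comm,
        X.inner_wickLp_multipleIntegral hf, TensorPow.pow_zero_succ, inner_zero_left, mul_zero]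
    | succ k =>
      exact X.inner_eq_zero_of_mem_chaosGraph hqk (X.mem_chaosGraph_multipleIntegral hf)
        (X.mem_chaosGraph_multipleIntegral hg)

/-- An element of `L²_X` is determined as a multiple integral by its `S`-transform. -/
theorem eq_multipleIntegral {q : ℕ} {f : TensorPow X.Integrands q}
    (hf : f ∈ TensorPow.symmetric X.Integrands q) {η : Lp ℝ 2 P} (hη : η ∈ X.L2X)
    (h : ∀ g, ⟪X.wickLp g, η⟫_ℝ = ⟪TensorPow.pow g q, f⟫_ℝ) : η = X.multipleIntegral q f :=
  X.eq_of_inner_wickLp_eq hη (X.multipleIntegral_mem_L2X hf) fun g => by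
    rw [h, X.inner_wickLp_multipleIntegral hf]

/-- The value of `multipleIntegral` is picked by choice, so linearity is not built in; it follows
because the `S`-transform determines elements of `L²_X`. -/
theorem multipleIntegral_add {q : ℕ} {f g : TensorPow X.Integrands q}
    (hf : f ∈ TensorPow.symmetric X.Integrands q) (hg : g ∈ TensorPow.symmetric X.Integrands q) :
    X.multipleIntegral q (f + g) = X.multipleIntegral q f + X.multipleIntegral q g := by
  refine (X.eq_multipleIntegral (Submodule.add_mem _ hf hg) (Submodule.add_mem _
    (X.multipleIntegral_mem_L2X hf) (X.multipleIntegral_mem_L2X hg)) fun x => ?_).symm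
  rw [inner_add_right, inner_add_right, X.inner_wickLp_multipleIntegral hf,
    X.inner_wickLp_multipleIntegral hg]

theorem multipleIntegral_smul {q : ℕ} (a : ℝ) {f : TensorPow X.Integrands q}
    (hf : f ∈ TensorPow.symmetric X.Integrands q) :
    X.multipleIntegral q (a • f) = a • X.multipleIntegral q f := by
  refine (X.eq_multipleIntegral (Submodule.smul_mem _ a hf) (Submodule.smul_mem _ a
    (X.multipleIntegral_mem_L2X hf)) fun x => ?_).symm
  rw [real_inner_smul_right, real_inner_smul_right, X.inner_wickLp_multipleIntegral hf]

/-- The normalised multiple integral `f ↦ I_q(f) / √q!` as a linear isometry. -/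
def chaosIsometry (q : ℕ) : TensorPow.symmetric X.Integrands q →ₗᵢ[ℝ] Lp ℝ 2 P where
  toFun f := (√(q ! : ℝ))⁻¹ • X.multipleIntegral q f
  map_add' f g := by
    rw [Submodule.coe_add, X.multipleIntegral_add f.2 g.2, smul_add]
  map_smul' a f := by
    rw [Submodule.coe_smul, X.multipleIntegral_smul a f.2, RingHom.id_apply, smul_comm]
  norm_map' f := by
    change ‖(√(q ! : ℝ))⁻¹ • X.multipleIntegral q f‖ = ‖f‖
    have : √(q ! : ℝ) ≠ 0 := (Real.sqrt_pos.mpr (by positivity)).ne'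
    rw [norm_smul, X.norm_multipleIntegral f.2, norm_inv, Real.norm_of_nonneg (Real.sqrt_nonneg _),
      inv_mul_cancel_left₀ this, Submodule.coe_norm]

theorem chaosIsometry_apply (q : ℕ) (f : TensorPow.symmetric X.Integrands q) :
    X.chaosIsometry q f = (√(q ! : ℝ))⁻¹ • X.multipleIntegral q f := rfl

theorem multipleIntegral_eq_chaosIsometry {q : ℕ} {f : TensorPow X.Integrands q}
    (hf : f ∈ TensorPow.symmetric X.Integrands q) :
    X.multipleIntegral q f = X.chaosIsometry q (√(q ! : ℝ) • ⟨f, hf⟩) := by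
  have : √(q ! : ℝ) ≠ 0 := (Real.sqrt_pos.mpr (by positivity)).ne'
  rw [map_smul, chaosIsometry_apply, smul_smul, mul_inv_cancel₀ this, one_smul]

theorem orthogonalFamily_chaosIsometry :
    OrthogonalFamily ℝ (fun q => TensorPow.symmetric X.Integrands q) X.chaosIsometry := by
  intro q k hqk f g
  rw [chaosIsometry_apply, chaosIsometry_apply, real_inner_smul_left, real_inner_smul_right,
    X.inner_multipleIntegral_eq_zero hqk f.2 g.2, mul_zero, mul_zero]

/-- An orthogonal series converges iff its squared norms are summable, and `‖I_k f‖² = k! ‖f‖²`. -/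
theorem summable_multipleIntegral_iff {f : (k : ℕ) → TensorPow X.Integrands k}
    (hf : ∀ k, f k ∈ TensorPow.symmetric X.Integrands k) :
    Summable (fun k => X.multipleIntegral k (f k)) ↔
      Summable fun k : ℕ => (k ! : ℝ) * ‖f k‖ ^ 2 := by
  have h := X.orthogonalFamily_chaosIsometry.summable_iff_norm_sq_summable
    (fun k => √(k ! : ℝ) • ⟨f k, hf k⟩)
  have e1 : (fun k => X.multipleIntegral k (f k)) =
      fun k => X.chaosIsometry k (√(k ! : ℝ) • ⟨f k, hf k⟩) :=
    funext fun k => X.multipleIntegral_eq_chaosIsometry (hf k)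
  have e2 : (fun k : ℕ => (k ! : ℝ) * ‖f k‖ ^ 2) =
      fun k => ‖√(k ! : ℝ) • (⟨f k, hf k⟩ : TensorPow.symmetric X.Integrands k)‖ ^ 2 := by
    funext k
    rw [norm_smul, mul_pow, Real.norm_of_nonneg (Real.sqrt_nonneg _),
      Real.sq_sqrt (by positivity), Submodule.coe_norm]
  rw [e1, e2]
  exact h

/-! ### Chaos expansions -/

variable {X}

theorem IsChaosExpansion.mem_L2X {f : (k : ℕ) → TensorPow X.Integrands k} {ξ : Lp ℝ 2 P}
    (h : X.IsChaosExpansion f ξ) : ξ ∈ X.L2X :=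
  X.isClosed_L2X.mem_of_tendsto h.2
    (Filter.Eventually.of_forall fun _ =>
      Submodule.sum_mem _ fun k _ => X.multipleIntegral_mem_L2X (h.1 k))

theorem IsChaosExpansion.hasSum_inner_wickLp {f : (k : ℕ) → TensorPow X.Integrands k}
    {ξ : Lp ℝ 2 P} (h : X.IsChaosExpansion f ξ) (g : X.Integrands) :
    HasSum (fun k => ⟪TensorPow.pow g k, f k⟫_ℝ) ⟪X.wickLp g, ξ⟫_ℝ := by
  have := (innerSL ℝ (X.wickLp g)).hasSum h.2
  simp only [innerSL_apply_apply, X.inner_wickLp_multipleIntegral (h.1 _)] at this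
  exact this

theorem IsChaosExpansion.summable {f : (k : ℕ) → TensorPow X.Integrands k} {ξ : Lp ℝ 2 P}
    (h : X.IsChaosExpansion f ξ) : Summable fun k : ℕ => (k ! : ℝ) * ‖f k‖ ^ 2 :=
  (X.summable_multipleIntegral_iff h.1).mp h.2.summable

variable (X)

theorem exists_isChaosExpansion_of_summable {f : (k : ℕ) → TensorPow X.Integrands k}
    (hf : ∀ k, f k ∈ TensorPow.symmetric X.Integrands k)
    (hs : Summable fun k : ℕ => (k ! : ℝ) * ‖f k‖ ^ 2) : ∃ ξ, X.IsChaosExpansion f ξ :=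
  ⟨_, hf, ((X.summable_multipleIntegral_iff hf).mpr hs).hasSum⟩

/-- The proposed series converges, and its `S`-transform at `h` is the exponential series of `⟪h,
g⟫`, as is that of the Wick exponential; totality identifies the two. -/
theorem isChaosExpansion_wickLp (g : X.Integrands) :
    X.IsChaosExpansion (fun k => (k ! : ℝ)⁻¹ • TensorPow.pow g k) (X.wickLp g) := by
  have hf : ∀ k, (k ! : ℝ)⁻¹ • TensorPow.pow g k ∈ TensorPow.symmetric X.Integrands k := fun k =>
    Submodule.smul_mem _ _ (TensorPow.pow_mem_symmetric g k)
  have hs : Summable fun k : ℕ => (k ! : ℝ) * ‖(k ! : ℝ)⁻¹ • TensorPow.pow g k‖ ^ 2 := by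
    refine (Real.summable_pow_div_factorial (‖g‖ ^ 2)).congr fun k => ?_
    rw [norm_smul, TensorPow.norm_pow, norm_inv, Real.norm_of_nonneg (by positivity)]
    have : (k ! : ℝ) ≠ 0 := by positivity
    field_simp
    ring
  obtain ⟨η, hη⟩ := X.exists_isChaosExpansion_of_summable hf hs
  have : X.wickLp g = η := by
    refine X.eq_of_inner_wickLp_eq (X.wickLp_mem_L2X g) hη.mem_L2X fun h => ?_
    refine HasSum.unique ?_ (hη.hasSum_inner_wickLp h)
    rw [inner_wickLp, Real.exp_eq_exp_ℝ]
    refine (NormedSpace.expSeries_div_hasSum_exp ⟪h, g⟫_ℝ).congr_fun fun k => ?_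
    rw [real_inner_smul_right, TensorPow.inner_pow, div_eq_inv_mul]
  rw [this]
  exact hη

/-- The Wiener chaos expansion. -/
theorem exists_isChaosExpansion {ξ : Lp ℝ 2 P} (hξ : ξ ∈ X.L2X) :
    ∃ f, X.IsChaosExpansion f ξ := by
  set V := X.orthogonalFamily_chaosIsometry.linearIsometry with hV
  have hsymm : ∀ k, CompleteSpace (TensorPow.symmetric X.Integrands k) := fun k =>
    (TensorPow.isClosed_symmetric k).completeSpace_coe
  set K := LinearMap.range V.toLinearMap with hK
  have hKc : IsClosed (K : Set (Lp ℝ 2 P)) := by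
    rw [hK, X.orthogonalFamily_chaosIsometry.range_linearIsometry]
    exact Submodule.isClosed_topologicalClosure _
  have hKm : ∀ (k : ℕ) (f : TensorPow X.Integrands k),
      f ∈ TensorPow.symmetric X.Integrands k → X.multipleIntegral k f ∈ K := by
    intro k f hf
    rw [hK, X.orthogonalFamily_chaosIsometry.range_linearIsometry,
      X.multipleIntegral_eq_chaosIsometry hf]
    exact Submodule.le_topologicalClosure _
      (Submodule.mem_iSup_of_mem k (LinearMap.mem_range_self _ _))
  have hexp : ∀ η ∈ K, ∃ f, X.IsChaosExpansion f η := by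
    rintro _ ⟨w, rfl⟩
    refine ⟨fun k => (√(k ! : ℝ))⁻¹ • (w k : TensorPow X.Integrands k),
      fun k => Submodule.smul_mem _ _ (w k).2, ?_⟩
    refine (X.orthogonalFamily_chaosIsometry.hasSum_linearIsometry w).congr_fun fun k => ?_
    rw [X.multipleIntegral_smul _ (w k).2, chaosIsometry_apply]
  have : CompleteSpace K := hKc.completeSpace_coe
  -- Project onto the closed sum `K` of all chaoses. Wick exponentials lie in `K` by their
  -- expansion, so the remainder `ζ` is orthogonal to them and vanishes.
  obtain ⟨η, hη, ζ, hζ, rfl⟩ := K.exists_add_mem_mem_orthogonal ξ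
  obtain ⟨f, hf⟩ := hexp η hη
  have hζ0 : ζ = 0 := by
    refine X.eq_zero_of_inner_wickLp_eq_zero ((Submodule.add_mem_iff_right _ hf.mem_L2X).mp hξ)
      fun g => ?_
    refine (Submodule.mem_orthogonal K ζ).mp hζ _ ?_
    have hg := X.isChaosExpansion_wickLp g
    exact hKc.mem_of_tendsto hg.2 (Filter.Eventually.of_forall fun _ =>
      Submodule.sum_mem _ fun k _ => hKm k _ (hg.1 k))
  exact ⟨f, by rwa [hζ0, add_zero]⟩

end CenteredGaussianProc

/-! ### Power series and rearrangement of double series -/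

theorem eq_zero_of_forall_hasSum_mul_pow {a : ℕ → ℝ}
    (h : ∀ t : ℝ, HasSum (fun n => t ^ n * a n) 0) (n : ℕ) : a n = 0 := by
  have hp : HasFPowerSeriesAt (fun _ : ℝ => (0 : ℝ)) (FormalMultilinearSeries.ofScalars ℝ a) 0 := by
    rw [hasFPowerSeriesAt_iff]
    refine Filter.Eventually.of_forall fun t => ?_
    simpa [FormalMultilinearSeries.coeff_ofScalars] using h t
  have := congrArg (fun p => p.coeff n) hp.eq_zero
  rw [FormalMultilinearSeries.coeff_ofScalars] at this
  rw [this]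
  rfl

/-- With `x = a_k` and `y = R^k / k!`, the inequality `xy ≤ x² + y²` multiplied by `k!` bounds the
term by `k! a_k² + R^{2k} / k!`. -/
theorem summable_mul_norm_of_summable_factorial_mul_sq {a : ℕ → ℝ} (ha : ∀ k, 0 ≤ a k)
    (h : Summable fun k : ℕ => (k ! : ℝ) * a k ^ 2) {R : ℝ} (hR : 0 ≤ R) :
    Summable fun k => R ^ k * a k := by
  refine Summable.of_nonneg_of_le (fun k => mul_nonneg (pow_nonneg hR k) (ha k)) (fun k => ?_)
    (h.add (Real.summable_pow_div_factorial (R ^ 2)))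
  have hk : (0 : ℝ) < k ! := by positivity
  have e : (R ^ 2) ^ k / (k ! : ℝ) = (k ! : ℝ) * (R ^ k / k !) ^ 2 := by
    field_simp
    ring
  have e2 : R ^ k * a k = (k ! : ℝ) * ((R ^ k / k !) * a k) := by field_simp
  rw [e, e2, ← mul_add]
  refine mul_le_mul_of_nonneg_left ?_ hk.le
  nlinarith [sq_nonneg (a k - R ^ k / k !), sq_nonneg (a k), sq_nonneg (R ^ k / (k ! : ℝ))]

/-- The bound on antidiagonal sums of norms gives absolute summability over `ℕ × ℕ`, after which the
order of summation is free. -/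
theorem hasSum_of_hasSum_antidiagonal {F : ℕ × ℕ → ℝ} {B : ℕ → ℝ} (hB : Summable B)
    (hF : ∀ k, ∑ p ∈ Finset.HasAntidiagonal.antidiagonal k, ‖F p‖ ≤ B k) {s : ℝ}
    (hs : HasSum (fun k => ∑ p ∈ Finset.HasAntidiagonal.antidiagonal k, F p) s) : HasSum F s := by
  set e := Finset.HasAntidiagonal.sigmaAntidiagonalEquivProd (A := ℕ)
  have hsig : Summable (F ∘ e) := by
    refine Summable.of_norm ?_
    rw [summable_sigma_of_nonneg fun _ => norm_nonneg _]
    refine ⟨fun k => (hasSum_fintype _).summable, ?_⟩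
    refine Summable.of_nonneg_of_le (fun k => tsum_nonneg fun _ => norm_nonneg _) (fun k => ?_) hB
    rw [tsum_fintype]
    refine le_trans (le_of_eq ?_) (hF k)
    exact Finset.sum_coe_sort (Finset.HasAntidiagonal.antidiagonal k) fun p => ‖F p‖
  have h2 := hsig.hasSum.sigma fun k => hasSum_fintype _
  have h3 : ∑' x, (F ∘ e) x = s := by
    refine h2.unique (hs.congr_fun fun k => ?_)
    exact Finset.sum_coe_sort (Finset.HasAntidiagonal.antidiagonal k) F
  rw [← e.hasSum_iff, ← h3]
  exact hsig.hasSum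

/-! ### New coefficients and the shifted `S`-transform -/

namespace CenteredGaussianProc

variable {Ω : Type*} [MeasurableSpace Ω] {P : Measure Ω} {T : ℝ} {X : CenteredGaussianProc P T}
  (hX : X.HasIndefiniteWienerIntegral) (r : Set.Icc (0 : ℝ) T) (c : X.Integrands)

/-- The binomial coefficient times `‖c_r‖^j` is one term in the expansion of `(1 + ‖c_r‖)^{n+j}`, a
geometric growth that the factorial weights absorb. -/
theorem norm_newCoeffTerm_le (f : (k : ℕ) → TensorPow X.Integrands k) (n j : ℕ) :
    ‖newCoeffTerm hX r c f n j‖ ≤ ‖TensorPow.map (hX.trunc r) n‖ *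
      ((1 + ‖shift hX r c‖) ^ (n + j) * ‖f (n + j)‖) := by
  have h1 : ((n + j).choose n : ℝ) * ‖shift hX r c‖ ^ j ≤ (1 + ‖shift hX r c‖) ^ (n + j) := by
    rw [add_pow]
    have := Finset.single_le_sum (f := fun m => (1 : ℝ) ^ m * ‖shift hX r c‖ ^ (n + j - m) *
      ((n + j).choose m : ℝ)) (s := Finset.range (n + j + 1)) (fun m _ => by positivity)
      (Finset.mem_range.mpr (by omega : n < n + j + 1))
    simpa [mul_comm] using this
  rw [newCoeffTerm, norm_smul, Real.norm_of_nonneg (by positivity)]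
  calc ((n + j).choose n : ℝ) * ‖TensorPow.map (hX.trunc r) n
        (TensorPow.contractPow (shift hX r c) n j (f (n + j)))‖
      ≤ ((n + j).choose n : ℝ) * (‖TensorPow.map (hX.trunc r) n‖ *
          (‖shift hX r c‖ ^ j * ‖f (n + j)‖)) := by
        gcongr
        refine (ContinuousLinearMap.le_opNorm _ _).trans ?_
        gcongr
        exact TensorPow.norm_contractPow_le _ _ _ _
    _ = ‖TensorPow.map (hX.trunc r) n‖ *
          (((n + j).choose n : ℝ) * ‖shift hX r c‖ ^ j * ‖f (n + j)‖) := by ring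
    _ ≤ _ := by gcongr

theorem summable_newCoeffTerm {f : (k : ℕ) → TensorPow X.Integrands k}
    (hs : Summable fun k : ℕ => (k ! : ℝ) * ‖f k‖ ^ 2) (n : ℕ) :
    Summable (newCoeffTerm hX r c f n) := by
  refine Summable.of_norm_bounded ?_ (norm_newCoeffTerm_le hX r c f n)
  refine Summable.mul_left _ ?_
  have := summable_mul_norm_of_summable_factorial_mul_sq (fun k => norm_nonneg (f k)) hs
    (R := 1 + ‖shift hX r c‖) (by positivity)
  exact ((summable_nat_add_iff n).mpr this).congr fun j => by rw [add_comm j n]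

theorem newCoeffTerm_mem_symmetric {f : (k : ℕ) → TensorPow X.Integrands k}
    (hf : ∀ k, f k ∈ TensorPow.symmetric X.Integrands k) (n j : ℕ) :
    newCoeffTerm hX r c f n j ∈ TensorPow.symmetric X.Integrands n :=
  Submodule.smul_mem _ _ (TensorPow.map_mem_symmetric _
    (TensorPow.contractPow_mem_symmetric _ n j (hf (n + j))))

theorem newCoeff_mem_symmetric {f : (k : ℕ) → TensorPow X.Integrands k}
    (hf : ∀ k, f k ∈ TensorPow.symmetric X.Integrands k) (n : ℕ) :
    newCoeff hX r c f n ∈ TensorPow.symmetric X.Integrands n :=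
  tsum_mem (TensorPow.isClosed_symmetric n) fun j => newCoeffTerm_mem_symmetric hX r c hf n j

theorem inner_newCoeffTerm (f : (k : ℕ) → TensorPow X.Integrands k) (n j : ℕ) (h : X.Integrands) :
    ⟪TensorPow.pow h n, newCoeffTerm hX r c f n j⟫_ℝ = ((n + j).choose n : ℝ) *
      ⟪TensorPow.contractPow (shift hX r c) n j (f (n + j)),
        TensorPow.pow (ContinuousLinearMap.adjoint (hX.trunc r) h) n⟫_ℝ := by
  rw [newCoeffTerm, real_inner_smul_right, real_inner_comm, TensorPow.inner_map_pow]

/-- The shifted chaos series, regrouped by the order of the new coefficients. -/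
theorem hasSum_inner_newCoeff {f : (k : ℕ) → TensorPow X.Integrands k}
    (hf : ∀ k, f k ∈ TensorPow.symmetric X.Integrands k)
    (hs : Summable fun k : ℕ => (k ! : ℝ) * ‖f k‖ ^ 2) (h : X.Integrands) {s : ℝ}
    (hsum : HasSum (fun k => ⟪TensorPow.pow
      (ContinuousLinearMap.adjoint (hX.trunc r) (h + c) - c) k, f k⟫_ℝ) s) :
    HasSum (fun n => ⟪TensorPow.pow h n, newCoeff hX r c f n⟫_ℝ) s := by
  set a := ContinuousLinearMap.adjoint (hX.trunc r) h with ha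
  set b := shift hX r c with hb
  set F : ℕ × ℕ → ℝ := fun p => ⟪TensorPow.pow h p.1, newCoeffTerm hX r c f p.1 p.2⟫_ℝ with hF
  -- The shift enters only through this splitting: `a` depends linearly on `h`, and `b = c_r` is
  -- fixed.
  have harg : ContinuousLinearMap.adjoint (hX.trunc r) (h + c) - c = a + b := by
    rw [map_add, add_sub_assoc]
    rfl
  have hFle : ∀ k, ∀ p ∈ Finset.HasAntidiagonal.antidiagonal k,
      ‖F p‖ ≤ (‖a‖ ^ p.1 * ‖b‖ ^ p.2 * (k.choose p.1 : ℝ)) * ‖f k‖ := by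
    rintro k ⟨n, j⟩ hp
    obtain rfl : n + j = k := Finset.HasAntidiagonal.mem_antidiagonal.mp hp
    simp only [hF]
    rw [inner_newCoeffTerm, norm_mul, Real.norm_of_nonneg (by positivity)]
    calc ((n + j).choose n : ℝ) * ‖⟪TensorPow.contractPow b n j (f (n + j)),
          TensorPow.pow a n⟫_ℝ‖
        ≤ ((n + j).choose n : ℝ) * ((‖b‖ ^ j * ‖f (n + j)‖) * ‖a‖ ^ n) := by
          gcongr
          refine (norm_inner_le_norm _ _).trans ?_
          rw [TensorPow.norm_pow]
          gcongr
          exact TensorPow.norm_contractPow_le _ _ _ _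
      _ = _ := by ring
  have hFk : ∀ k, ∑ p ∈ Finset.HasAntidiagonal.antidiagonal k, ‖F p‖ ≤
      (‖a‖ + ‖b‖) ^ k * ‖f k‖ := by
    intro k
    refine (Finset.sum_le_sum (hFle k)).trans (le_of_eq ?_)
    rw [← Finset.sum_mul, add_pow, Finset.Nat.sum_antidiagonal_eq_sum_range_succ_mk]
  have hFsum : HasSum F s := by
    refine hasSum_of_hasSum_antidiagonal (summable_mul_norm_of_summable_factorial_mul_sq
      (fun k => norm_nonneg (f k)) hs (R := ‖a‖ + ‖b‖) (by positivity)) hFk ?_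
    refine hsum.congr_fun fun k => ?_
    rw [harg, real_inner_comm, TensorPow.inner_pow_add a b k f (hf k)]
    exact Finset.sum_congr rfl fun p _ => inner_newCoeffTerm hX r c f p.1 p.2 h
  -- The antidiagonals of `F` gave the shifted series; its rows sum to the pairings with the new
  -- coefficients.
  refine hFsum.prod_fiberwise fun n => ?_
  have := (innerSL ℝ (TensorPow.pow h n)).hasSum (summable_newCoeffTerm hX r c hs n).hasSum
  simp only [innerSL_apply_apply] at this
  exact this

variable [IsProbabilityMeasure P]

theorem hasSum_sTransform_shift {f : (k : ℕ) → TensorPow X.Integrands k} {ξ : Lp ℝ 2 P}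
    (hξ : X.IsChaosExpansion f ξ) (h : X.Integrands) :
    HasSum (fun n => ⟪TensorPow.pow h n, newCoeff hX r c f n⟫_ℝ)
      (X.sTransform ξ (ContinuousLinearMap.adjoint (hX.trunc r) (h + c) - c)) := by
  rw [sTransform_eq_inner]
  exact hasSum_inner_newCoeff hX r c hξ.1 hξ.summable h (hξ.hasSum_inner_wickLp _)

omit hX r c in
-- Replacing `x` by `t x` multiplies the `n`th term by `t^n`, so both sides become power series in
-- `t` and agree term by term; pairings with powers then determine the symmetric tensors.
theorem IsChaosExpansion.eq_of_hasSum {g g' : (k : ℕ) → TensorPow X.Integrands k} {η : Lp ℝ 2 P}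
    (hη : X.IsChaosExpansion g η) (hg' : ∀ k, g' k ∈ TensorPow.symmetric X.Integrands k)
    (h : ∀ x, HasSum (fun n => ⟪TensorPow.pow x n, g' n⟫_ℝ) (X.sTransform η x)) : g = g' := by
  funext n
  rw [← sub_eq_zero]
  refine TensorPow.eq_zero_of_mem_symmetric (Submodule.sub_mem _ (hη.1 n) (hg' n)) fun x => ?_
  rw [real_inner_comm]
  refine eq_zero_of_forall_hasSum_mul_pow (a := fun n => ⟪TensorPow.pow x n, g n - g' n⟫_ℝ)
    (fun t => ?_) n
  have h1 := hη.hasSum_inner_wickLp (t • x)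
  rw [← sTransform_eq_inner] at h1
  have h2 := h1.sub (h (t • x))
  rw [sub_self] at h2
  refine h2.congr_fun fun k => ?_
  rw [← inner_sub_right, TensorPow.pow_smul, real_inner_smul_left]

/-- The chaos expansion of `η` and the regrouped shifted series of `ξ` are both power series in `h`.
Uniqueness of coefficients gives one direction, uniqueness of sums the other. As this holds for
every witness, the choice in `quasiCondExp` is harmless. -/
theorem isShiftedQuasiCondExp_iff {f : (k : ℕ) → TensorPow X.Integrands k} {ξ η : Lp ℝ 2 P}
    (hξ : X.IsChaosExpansion f ξ) :
    IsShiftedQuasiCondExp hX r c ξ η ↔ X.IsChaosExpansion (newCoeff hX r c f) η := by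
  constructor
  · rintro ⟨hη, h⟩
    obtain ⟨g, hg⟩ := X.exists_isChaosExpansion hη
    rwa [← hg.eq_of_hasSum (newCoeff_mem_symmetric hX r c hξ.1) fun x => by
      rw [← h]; exact hasSum_sTransform_shift hX r c hξ x]
  · intro hη
    refine ⟨hη.mem_L2X, fun h => ?_⟩
    rw [X.sTransform_eq_inner η]
    exact (hasSum_sTransform_shift hX r c hξ h).unique (hη.hasSum_inner_wickLp h)

theorem mem_quasiDomain_iff {f : (k : ℕ) → TensorPow X.Integrands k} {ξ : Lp ℝ 2 P}
    (hξ : X.IsChaosExpansion f ξ) :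
    ξ ∈ quasiDomain hX r c ↔
      Summable fun k : ℕ => (k ! : ℝ) * ‖newCoeff hX r c f k‖ ^ 2 := by
  constructor
  · rintro ⟨_, η, hη⟩
    exact ((isShiftedQuasiCondExp_iff hX r c hξ).mp hη).summable
  · intro hs
    obtain ⟨η, hη⟩ := X.exists_isChaosExpansion_of_summable
      (newCoeff_mem_symmetric hX r c hξ.1) hs
    exact ⟨hξ.mem_L2X, η, (isShiftedQuasiCondExp_iff hX r c hξ).mpr hη⟩

theorem isChaosExpansion_quasiCondExp {f : (k : ℕ) → TensorPow X.Integrands k} {ξ : Lp ℝ 2 P}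
    (hξ : X.IsChaosExpansion f ξ) (hD : ξ ∈ quasiDomain hX r c) :
    X.IsChaosExpansion (newCoeff hX r c f) (quasiCondExp hX r c ξ) := by
  rw [quasiCondExp, dif_pos hD.2]
  exact (isShiftedQuasiCondExp_iff hX r c hξ).mp hD.2.choose_spec

end CenteredGaussianProc

end

/-- Summability of the coefficient terms belongs to the conclusion because `tsum` takes the default
value `0` on a divergent series. The set equality additionally uses that every element of `L²_X` has
a chaos expansion. -/
theorem theorem4p11 {Ω : Type*} [MeasurableSpace Ω] (P : Measure Ω) [IsProbabilityMeasure P]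
    (T : ℝ) (X : CenteredGaussianProc P T) (hX : X.HasIndefiniteWienerIntegral)
    (r : Set.Icc (0 : ℝ) T) (c : X.Integrands) :
    CenteredGaussianProc.quasiDomain hX r c =
        {ξ | ∃ f, X.IsChaosExpansion f ξ ∧
          Summable fun k : ℕ => (k ! : ℝ) *
            ‖CenteredGaussianProc.newCoeff hX r c f k‖ ^ 2} ∧
      ∀ (ξ : Lp ℝ 2 P) (f : (k : ℕ) → TensorPow X.Integrands k), X.IsChaosExpansion f ξ →
        (∀ n, Summable (CenteredGaussianProc.newCoeffTerm hX r c f n) ∧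
          CenteredGaussianProc.newCoeff hX r c f n ∈ TensorPow.symmetric X.Integrands n) ∧
        (ξ ∈ CenteredGaussianProc.quasiDomain hX r c ↔
          Summable fun k : ℕ => (k ! : ℝ) *
            ‖CenteredGaussianProc.newCoeff hX r c f k‖ ^ 2) ∧
        (ξ ∈ CenteredGaussianProc.quasiDomain hX r c →
          X.IsChaosExpansion (CenteredGaussianProc.newCoeff hX r c f)
            (CenteredGaussianProc.quasiCondExp hX r c ξ)) := by
  refine ⟨Set.ext fun ξ => ⟨fun hD => ?_, ?_⟩, fun ξ f hξ => ⟨fun n => ⟨?_, ?_⟩, ?_, fun hD => ?_⟩⟩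
  · obtain ⟨f, hf⟩ := X.exists_isChaosExpansion hD.1
    exact ⟨f, hf, (CenteredGaussianProc.mem_quasiDomain_iff hX r c hf).mp hD⟩
  · rintro ⟨f, hf, hs⟩
    exact (CenteredGaussianProc.mem_quasiDomain_iff hX r c hf).mpr hs
  · exact CenteredGaussianProc.summable_newCoeffTerm hX r c hξ.summable n
  · exact CenteredGaussianProc.newCoeff_mem_symmetric hX r c hξ.1 n
  · exact CenteredGaussianProc.mem_quasiDomain_iff hX r c hξ
  · exact CenteredGaussianProc.isChaosExpansion_quasiCondExp hX r c hξ hD
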